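/- Let $\mathcal V$ be a real or complex Hilbert space, $D$ a (possibly unbounded, densely defined) skew-adjoint Fredholm operator on $\mathcal V$, and $Q$ a skew-adjoint Hilbert--Schmidt operator on $\mathcal V$. (Fredholm: $D$ is closed with finite-dimensional kernel and closed range of finite codimension.) For a skew-adjoint operator $D$ on a complex Hilbert space put $J_D = i\,\mathrm{sign}(\tfrac1i D)$, using the Borel functional calculus of the self-adjoint operator $\tfrac1i D$ and $\mathrm{sign}(0)=0$. If $\mathcal V$ is real, the spectrum of $D$ is that of its complex-linear extension to $\mathcal V^{\mathbb C}$, and $J_D$ is the bounded operator on $\mathcal V$ whose complex-linear extension is $i\,\mathrm{sign}(\tfrac1i D)$ computed in $\mathcal V^{\mathbb C}$. Then $J_D$ and $J_{D+Q}$ are well defined (and, in the real case, real), and $J_{D+Q}-J_D$ is Hilbert--Schmidt. Moreover, if $0$ lies neither in the spectrum of $D$ nor in that of $D+Q$, then the distance $a\in(0,\infty]$ from $0$ to the union of the two spectra is positive, and $$\|J_{D+Q}-J_D\|_{HS}\le \frac1a\,\|Q\|_{HS}.$$ (Here $a=\infty$ only if $\mathcal V=0$, and then both sides are $0$.) -/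

import Mathlib

open scoped ENNReal

noncomputable section

set_option linter.unusedSectionVars false

namespace SkewFredholm

/-! ### Hilbert–Schmidt operators -/

section HilbertSchmidt

variable {𝕜 H : Type*} [RCLike 𝕜] [NormedAddCommGroup H] [InnerProductSpace 𝕜 H] [CompleteSpace H]

/-- The index set of a fixed orthonormal basis of the Hilbert space `H`. -/
def basisSet (𝕜 H : Type*) [RCLike 𝕜] [NormedAddCommGroup H] [InnerProductSpace 𝕜 H]
    [CompleteSpace H] : Set H :=
  (exists_hilbertBasis 𝕜 H).choose

/-- A fixed orthonormal basis of the Hilbert space `H`. -/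
def basis (𝕜 H : Type*) [RCLike 𝕜] [NormedAddCommGroup H] [InnerProductSpace 𝕜 H]
    [CompleteSpace H] : HilbertBasis (basisSet 𝕜 H) 𝕜 H :=
  (exists_hilbertBasis 𝕜 H).choose_spec.choose

/-- The square of the Hilbert–Schmidt norm, `∑ ‖T eᵢ‖²` over an orthonormal basis, as an element
of `[0, ∞]`. It does not depend on the basis, see `hsNormSq_eq_tsum`. -/
def hsNormSq (T : H →L[𝕜] H) : ℝ≥0∞ := ∑' i, ‖T (basis 𝕜 H i)‖ₑ ^ 2

/-- The Hilbert–Schmidt norm, with value `∞` if `T` is not Hilbert–Schmidt. -/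
def hsNorm (T : H →L[𝕜] H) : ℝ≥0∞ := hsNormSq T ^ (1 / 2 : ℝ)

/-- `T` is Hilbert–Schmidt: its Hilbert–Schmidt norm is finite. -/
def IsHilbertSchmidt (T : H →L[𝕜] H) : Prop := hsNorm T < ∞

/-- Parseval's identity in `[0, ∞]`. -/
theorem tsum_enorm_inner_sq {ι : Type*} (b : HilbertBasis ι 𝕜 H) (x : H) :
    ∑' i, ‖inner 𝕜 (b i) x‖ₑ ^ 2 = ‖x‖ₑ ^ 2 := by
  have h : HasSum (fun i => ‖inner 𝕜 (b i) x‖ ^ 2) (‖x‖ ^ 2) := by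
    have h1 := (b.hasSum_inner_mul_inner x x).mapL (RCLike.reCLM (K := 𝕜))
    rw [RCLike.reCLM_apply, inner_self_eq_norm_sq] at h1
    have h2 : ∀ i, RCLike.re (inner 𝕜 x (b i) * inner 𝕜 (b i) x) = ‖inner 𝕜 (b i) x‖ ^ 2 :=
      fun i => by rw [inner_mul_symm_re_eq_norm, norm_mul, norm_inner_symm x, sq]
    simpa only [h2] using h1
  have h3 : ‖x‖ₑ ^ 2 = ENNReal.ofReal (‖x‖ ^ 2) := by
    rw [ENNReal.ofReal_pow (norm_nonneg x), ofReal_norm]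
  rw [h3, ← h.tsum_eq, ENNReal.ofReal_tsum_of_nonneg (fun i => by positivity) h.summable]
  exact tsum_congr fun i => by rw [ENNReal.ofReal_pow (norm_nonneg _), ofReal_norm]

theorem tsum_enorm_sq_eq_adjoint {ι κ : Type*} (b : HilbertBasis ι 𝕜 H) (c : HilbertBasis κ 𝕜 H)
    (T : H →L[𝕜] H) :
    ∑' k, ‖T (c k)‖ₑ ^ 2 = ∑' i, ‖ContinuousLinearMap.adjoint T (b i)‖ₑ ^ 2 := by
  simp_rw [← tsum_enorm_inner_sq b (T _)]
  rw [ENNReal.tsum_comm]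
  refine tsum_congr fun i => ?_
  rw [← tsum_enorm_inner_sq c (ContinuousLinearMap.adjoint T (b i))]
  refine tsum_congr fun k => ?_
  rw [ContinuousLinearMap.adjoint_inner_right,
    enorm_eq_iff_norm_eq.mpr (norm_inner_symm (b i) (T (c k)))]

/-- The Hilbert–Schmidt norm may be computed in any orthonormal basis. -/
theorem hsNormSq_eq_tsum {ι : Type*} (b : HilbertBasis ι 𝕜 H) (T : H →L[𝕜] H) :
    hsNormSq T = ∑' i, ‖T (b i)‖ₑ ^ 2 := by
  rw [hsNormSq, tsum_enorm_sq_eq_adjoint b (basis 𝕜 H), ← tsum_enorm_sq_eq_adjoint b b]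

end HilbertSchmidt

/-! ### Unbounded operators -/

section Unbounded

variable {𝕜 H : Type*} [RCLike 𝕜] [NormedAddCommGroup H] [InnerProductSpace 𝕜 H]

/-- A densely defined operator `D` is skew-adjoint if `D† = -D` (with equality of domains). -/
def IsSkewAdjointOp [CompleteSpace H] (D : H →ₗ.[𝕜] H) : Prop :=
  Dense (D.domain : Set H) ∧ D.adjoint = -D

/-- A possibly unbounded operator is Fredholm if it is closed, its kernel is finite-dimensional,
and its range is closed and of finite codimension. -/
structure IsFredholmOp (D : H →ₗ.[𝕜] H) : Prop where
  isClosed : D.IsClosed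
  finite_ker : FiniteDimensional 𝕜 (LinearMap.ker D.toFun)
  isClosed_range : IsClosed (LinearMap.range D.toFun : Set H)
  finite_coker : FiniteDimensional 𝕜 (H ⧸ LinearMap.range D.toFun)

/-- The operator `D + Q` for a bounded operator `Q`, with the domain of `D`. -/
def perturb (D : H →ₗ.[𝕜] H) (Q : H →L[𝕜] H) : H →ₗ.[𝕜] H :=
  (Q : H →ₗ[𝕜] H) +ᵥ D

/-- The bounded operator `R` is the resolvent `(A - z)⁻¹`, a two-sided inverse of
`A - z : dom A → H`. -/
def IsResolventAt (A : H →ₗ.[𝕜] H) (z : 𝕜) (R : H →L[𝕜] H) : Prop :=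
  (∀ x : H, ∃ h : R x ∈ A.domain, A ⟨R x, h⟩ - z • R x = x) ∧
    ∀ y : A.domain, R (A y - z • (y : H)) = y

/-- The spectrum of a possibly unbounded operator: the complement of the set of `z` for which
`A - z` has a bounded everywhere defined inverse. -/
def spectrumOp (A : H →ₗ.[𝕜] H) : Set 𝕜 := {z | ¬ ∃ R : H →L[𝕜] H, IsResolventAt A z R}

end Unbounded

/-! ### Functional calculus of an unbounded self-adjoint operator -/

section FunctionalCalculus

variable {H : Type*} [NormedAddCommGroup H] [InnerProductSpace ℂ H]

/-- The finite Borel measure `μ` on `ℝ` is the spectral measure of the self-adjoint operator `A`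
at the vector `x`, that is `⟪x, (A - z)⁻¹ x⟫ = ∫ (t - z)⁻¹ dμ(t)` for all non-real `z`.
(A finite measure on the real line is determined by this transform.) -/
def IsSpectralMeasureAt (A : H →ₗ.[ℂ] H) (x : H) (μ : MeasureTheory.Measure ℝ) : Prop :=
  MeasureTheory.IsFiniteMeasure μ ∧
    ∀ z : ℂ, z.im ≠ 0 → ∃ R : H →L[ℂ] H, IsResolventAt A z R ∧
      inner ℂ x (R x) = ∫ t : ℝ, ((t : ℂ) - z)⁻¹ ∂μ

/-- For a self-adjoint operator `A` and a bounded Borel function `f` on `ℝ`, the bounded operator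
`T` equals `f(A)`: one has `⟪x, T x⟫ = ∫ f dμₓ` for every vector `x`, where `μₓ` is the spectral
measure of `A` at `x`. -/
def IsFunctionOf (A : H →ₗ.[ℂ] H) (f : ℝ → ℝ) (T : H →L[ℂ] H) : Prop :=
  ∀ x : H, ∃ μ : MeasureTheory.Measure ℝ, IsSpectralMeasureAt A x μ ∧
    inner ℂ x (T x) = ∫ t : ℝ, (f t : ℂ) ∂μ

open Classical in
/-- The operator `f(A)`, for a self-adjoint operator `A` and a bounded Borel function `f`. -/
def functionOf (A : H →ₗ.[ℂ] H) (f : ℝ → ℝ) : H →L[ℂ] H :=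
  if h : ∃ T : H →L[ℂ] H, IsFunctionOf A f T then h.choose else 0

/-- The self-adjoint operator `(1/i) D` attached to a skew-adjoint operator `D`. -/
def overI (D : H →ₗ.[ℂ] H) : H →ₗ.[ℂ] H := (1 / Complex.I) • D

/-- The operator `J_D = i sign((1/i) D)`, where `sign 0 = 0`. -/
def skewSign (D : H →ₗ.[ℂ] H) : H →L[ℂ] H := Complex.I • functionOf (overI D) Real.sign

end FunctionalCalculus

/-! ### Complexification of a real Hilbert space -/

/-- The complexification `V ⊕ i V` of a real Hilbert space `V`. -/
def Complexification (V : Type*) : Type _ := WithLp 2 (V × V)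

namespace Complexification

variable {V : Type*}

/-- The vector `x + i y`. -/
def mk (x y : V) : Complexification V := WithLp.toLp 2 (x, y)

/-- The real part of a vector. -/
def re (x : Complexification V) : V := WithLp.fst x

/-- The imaginary part of a vector. -/
def im (x : Complexification V) : V := WithLp.snd x

@[simp] theorem re_mk (x y : V) : (mk x y).re = x := rfl

@[simp] theorem im_mk (x y : V) : (mk x y).im = y := rfl

@[simp] theorem mk_re_im (x : Complexification V) : mk x.re x.im = x := rfl

@[ext] theorem ext {x y : Complexification V} (h₁ : x.re = y.re) (h₂ : x.im = y.im) : x = y := by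
  rw [← mk_re_im x, ← mk_re_im y, h₁, h₂]

variable [NormedAddCommGroup V]

instance : NormedAddCommGroup (Complexification V) :=
  inferInstanceAs (NormedAddCommGroup (WithLp 2 (V × V)))

instance [CompleteSpace V] : CompleteSpace (Complexification V) :=
  inferInstanceAs (CompleteSpace (WithLp 2 (V × V)))

@[simp] theorem re_add (x y : Complexification V) : (x + y).re = x.re + y.re := rfl

@[simp] theorem im_add (x y : Complexification V) : (x + y).im = x.im + y.im := rfl

@[simp] theorem re_zero : (0 : Complexification V).re = 0 := rfl

@[simp] theorem im_zero : (0 : Complexification V).im = 0 := rfl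

theorem norm_sq (x : Complexification V) : ‖x‖ ^ 2 = ‖x.re‖ ^ 2 + ‖x.im‖ ^ 2 :=
  WithLp.prod_norm_sq_eq_of_L2 (α := V) (β := V) x

theorem continuous_re : Continuous (re : Complexification V → V) :=
  continuous_fst.comp (WithLp.prod_continuous_ofLp 2 V V)

theorem continuous_im : Continuous (im : Complexification V → V) :=
  continuous_snd.comp (WithLp.prod_continuous_ofLp 2 V V)

theorem continuous_mk {X : Type*} [TopologicalSpace X] {f g : X → V} (hf : Continuous f)
    (hg : Continuous g) : Continuous fun x => mk (f x) (g x) :=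
  (WithLp.prod_continuous_toLp 2 V V).comp (hf.prodMk hg)

variable [InnerProductSpace ℝ V]

/-- Scalar multiplication `(a + i b)(x + i y) = (a x - b y) + i (a y + b x)`. -/
instance : SMul ℂ (Complexification V) where
  smul c x := mk (c.re • x.re - c.im • x.im) (c.re • x.im + c.im • x.re)

@[simp] theorem re_smul (c : ℂ) (x : Complexification V) :
    (c • x).re = c.re • x.re - c.im • x.im := rfl

@[simp] theorem im_smul (c : ℂ) (x : Complexification V) :
    (c • x).im = c.re • x.im + c.im • x.re := rfl

instance : Module ℂ (Complexification V) where
  one_smul x := by ext <;> simp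
  mul_smul c d x := by ext <;> simp <;> module
  smul_zero c := by ext <;> simp
  smul_add c x y := by ext <;> simp <;> module
  add_smul c d x := by ext <;> simp <;> module
  zero_smul x := by ext <;> simp

theorem norm_smul_eq (c : ℂ) (x : Complexification V) : ‖c • x‖ = ‖c‖ * ‖x‖ := by
  rw [← sq_eq_sq₀ (norm_nonneg _) (by positivity), mul_pow, norm_sq, norm_sq, re_smul, im_smul,
    norm_sub_sq_real, norm_add_sq_real, Complex.sq_norm, Complex.normSq_apply]
  simp only [norm_smul, inner_smul_left, inner_smul_right, mul_pow, Real.norm_eq_abs, sq_abs,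
    real_inner_comm x.re x.im]
  simp
  ring

instance : NormedSpace ℂ (Complexification V) where
  norm_smul_le c x := (norm_smul_eq c x).le

/-- The Hermitian inner product extending that of `V`, antilinear in the first variable. -/
instance : InnerProductSpace ℂ (Complexification V) where
  inner x y := ⟨inner ℝ x.re y.re + inner ℝ x.im y.im, inner ℝ x.re y.im - inner ℝ x.im y.re⟩
  norm_sq_eq_re_inner x := by simp [norm_sq]
  conj_inner_symm x y := by
    apply Complex.ext <;> simp [real_inner_comm]
  add_left x y z := by
    apply Complex.ext <;> simp [inner_add_left] <;> ring
  smul_left x y r := by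
    apply Complex.ext <;>
      simp [inner_sub_left, inner_add_left, inner_smul_left] <;> ring

/-- The complex-linear extension of a bounded real operator, `T (x + i y) = T x + i T y`. -/
def mapL (T : V →L[ℝ] V) : Complexification V →L[ℂ] Complexification V where
  toFun x := mk (T x.re) (T x.im)
  map_add' x y := by ext <;> simp
  map_smul' c x := by ext <;> simp
  cont := continuous_mk (T.continuous.comp continuous_re) (T.continuous.comp continuous_im)

/-- The complex-linear extension of an unbounded real operator, with domain `dom D ⊕ i dom D`. -/
def mapP (D : V →ₗ.[ℝ] V) : Complexification V →ₗ.[ℂ] Complexification V where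
  domain :=
    { carrier := {x | x.re ∈ D.domain ∧ x.im ∈ D.domain}
      add_mem' := fun hx hy => ⟨D.domain.add_mem hx.1 hy.1, D.domain.add_mem hx.2 hy.2⟩
      zero_mem' := ⟨D.domain.zero_mem, D.domain.zero_mem⟩
      smul_mem' := fun c _ hx =>
        ⟨D.domain.sub_mem (D.domain.smul_mem c.re hx.1) (D.domain.smul_mem c.im hx.2),
          D.domain.add_mem (D.domain.smul_mem c.re hx.2) (D.domain.smul_mem c.im hx.1)⟩ }
  toFun :=
    { toFun := fun x => mk (D ⟨x.1.re, x.2.1⟩) (D ⟨x.1.im, x.2.2⟩)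
      map_add' := fun x y => by
        ext
        · exact D.map_add ⟨x.1.re, x.2.1⟩ ⟨y.1.re, y.2.1⟩
        · exact D.map_add ⟨x.1.im, x.2.2⟩ ⟨y.1.im, y.2.2⟩
      map_smul' := fun c x => by
        ext
        · refine (D.map_sub (c.re • ⟨x.1.re, x.2.1⟩) (c.im • ⟨x.1.im, x.2.2⟩)).trans ?_
          rw [D.map_smul, D.map_smul]
          rfl
        · refine (D.map_add (c.re • ⟨x.1.im, x.2.2⟩) (c.im • ⟨x.1.re, x.2.1⟩)).trans ?_
          rw [D.map_smul, D.map_smul]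
          rfl }

end Complexification

section Real

variable {V : Type*} [NormedAddCommGroup V] [InnerProductSpace ℝ V]

open Classical in
/-- For a real skew-adjoint operator `D`, the real operator `J_D` on `V`: the one whose
complex-linear extension is `i sign((1/i) D)`, computed in the complexification. -/
def realSkewSign (D : V →ₗ.[ℝ] V) : V →L[ℝ] V :=
  if h : ∃ J : V →L[ℝ] V,
    Complexification.mapL J = skewSign (Complexification.mapP D) then h.choose else 0

end Real

end SkewFredholm

end

open SkewFredholm

/-! Put A = (1/i)D and K = (1/i)Q. Then A and K are self-adjoint, (1/i)(D+Q) = A+K, and factors of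
modulus one do not change Hilbert–Schmidt norms, so everything concerns sign(A+K) − sign(A).

Existence of sign(A): N = (A−i)⁻¹ is bounded and normal, so the continuous functional calculus and
the Riesz theorem give it scalar measures. They do not charge w = 0, and the coordinate w = (t−i)⁻¹
carries them to spectral measures of A on the real line. Uniqueness: sign t is the limit of (1/π)∫
2t/(t²+s²) ds over [1/(n+1), n+1], so the quadratic form of sign(A) is a limit of integrals of
(A−is)⁻¹ + (A+is)⁻¹ (`IsSA.tendsto_inner_truncSign`), which involve resolvents only.

Sharp bound (`IsSA.hsNorm_sign_sub_le`): if A and A+K are bounded below by a, their resolvents at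
±is have norm at most (a²+s²)^(-1/2). The second resolvent identity then bounds each resolvent
difference by ‖K‖/(a²+s²) in Hilbert–Schmidt norm, and (1/π)∫₀^∞ 2/(a²+s²) ds = 1/a.

General case (`IsSA.isHilbertSchmidt_sign_sub`): a Fredholm D is bounded below by some c > 0 off a
finite-dimensional space, and a Hilbert–Schmidt perturbation preserves this for a smaller c. Near 0
both spectra are thus finite, so some small l > 0 lies in a gap of both. The sharp bound applies to
A−l and A+K−l, and moving the jump of the sign from 0 to l costs finite rank for each operator.

Real case: on the complexification, conjugation C satisfies CAC = −A. As the sign is odd, uniqueness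
gives C sign(A) C = −sign(A), so i·sign(A) commutes with C and is real. -/

namespace SkewFredholm

/-! ### Skew-adjointness through inner products -/

section Skew

variable {𝕜 H : Type*} [RCLike 𝕜] [NormedAddCommGroup H] [InnerProductSpace 𝕜 H]

/-- Skew-adjointness of a possibly unbounded operator, spelled out in terms of inner products. -/
structure IsSkew (D : H →ₗ.[𝕜] H) : Prop where
  dense : Dense (D.domain : Set H)
  skew : ∀ x y : D.domain, inner 𝕜 (D x) (y : H) = -inner 𝕜 (x : H) (D y)
  maximal : ∀ x z : H, (∀ y : D.domain, inner 𝕜 x (D y) = -inner 𝕜 z (y : H)) →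
    ∃ h : x ∈ D.domain, D ⟨x, h⟩ = z

theorem IsSkewAdjointOp.isSkew [CompleteSpace H] {D : H →ₗ.[𝕜] H} (hD : IsSkewAdjointOp D) :
    IsSkew D := by
  obtain ⟨hd, ha⟩ := hD
  have hdom : ∀ x, x ∈ D.adjoint.domain ↔ x ∈ D.domain := fun x => by rw [ha]; rfl
  have hval : ∀ (x : H) (h : x ∈ D.domain), D.adjoint ⟨x, (hdom x).2 h⟩ = - D ⟨x, h⟩ := by
    intro x h
    -- The domain proof depends on the operator, so the operator is generalized before the equation
    -- is substituted.
    have : ∀ (E : H →ₗ.[𝕜] H) (hE : E = -D) (h' : x ∈ E.domain), E ⟨x, h'⟩ = - D ⟨x, h⟩ := by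
      rintro E rfl h'
      rfl
    exact this _ ha _
  refine ⟨hd, fun x y => ?_, fun x z h => ?_⟩
  · have h1 := LinearPMap.adjoint_isFormalAdjoint hd ⟨x, (hdom x).2 x.2⟩ y
    rw [hval x x.2, inner_neg_left] at h1
    rw [← h1, neg_neg]
  · have hx : x ∈ D.adjoint.domain := LinearPMap.mem_adjoint_domain_of_exists x
      ⟨-z, fun y => by rw [inner_neg_left, h y]⟩
    refine ⟨(hdom x).1 hx, ?_⟩
    have h2 := LinearPMap.adjoint_apply_eq hd ⟨x, hx⟩ (x₀ := -z)
      (fun y => by rw [inner_neg_left, h y])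
    rw [hval x ((hdom x).1 hx)] at h2
    exact neg_injective h2

theorem perturb_apply (D : H →ₗ.[𝕜] H) (Q : H →L[𝕜] H) (x : (perturb D Q).domain) :
    perturb D Q x = Q x + D x := rfl

/-- Being bounded and skew, Q moves to the other side of the maximality condition: if x pairs with
D+Q as z prescribes, it pairs with D as z − Qx does. -/
theorem IsSkew.perturb [CompleteSpace H] {D : H →ₗ.[𝕜] H} (hD : IsSkew D) {Q : H →L[𝕜] H}
    (hQ : ContinuousLinearMap.adjoint Q = -Q) : IsSkew (perturb D Q) := by
  have hq : ∀ x y : H, inner 𝕜 (Q x) y = -inner 𝕜 x (Q y) := fun x y => by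
    rw [← ContinuousLinearMap.adjoint_inner_right, hQ]
    simp
  refine ⟨hD.dense, fun x y => ?_, fun x z h => ?_⟩
  · rw [perturb_apply, perturb_apply, inner_add_left, inner_add_right, hq, hD.skew x y]
    ring
  · obtain ⟨h1, h2⟩ := hD.maximal x (z - Q x) fun y => by
      have : inner 𝕜 x (Q y + D y) = -inner 𝕜 z (y : H) := h y
      rw [inner_add_right] at this
      rw [inner_sub_left, hq, eq_sub_of_add_eq' this]
      ring
    exact ⟨h1, by rw [perturb_apply]; erw [h2]; simp⟩

/-- Off a finite-dimensional subspace, the operator is bounded below. -/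
def IsEssBelow (D : H →ₗ.[𝕜] H) : Prop :=
  ∃ M : Submodule 𝕜 H, FiniteDimensional 𝕜 M ∧ ∃ c : ℝ, 0 < c ∧
    ∀ x : D.domain, (x : H) ∈ Mᗮ → c * ‖(x : H)‖ ≤ ‖D x‖

end Skew

/-! ### Self-adjoint operators and existence of resolvents -/

section SelfAdjoint

variable {H : Type*} [NormedAddCommGroup H] [InnerProductSpace ℂ H]

/-- Self-adjointness of a possibly unbounded operator, spelled out in terms of inner products. -/
structure IsSA (A : H →ₗ.[ℂ] H) : Prop where
  dense : Dense (A.domain : Set H)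
  symm : ∀ x y : A.domain, inner ℂ (A x) (y : H) = inner ℂ (x : H) (A y)
  maximal : ∀ x z : H, (∀ y : A.domain, inner ℂ x (A y) = inner ℂ z (y : H)) →
    ∃ h : x ∈ A.domain, A ⟨x, h⟩ = z

theorem overI_apply (D : H →ₗ.[ℂ] H) (x : (overI D).domain) :
    overI D x = (-Complex.I) • D x := by
  have : overI D x = (1 / Complex.I) • D x := rfl
  rw [this]
  simp

theorem IsSkew.isSA {D : H →ₗ.[ℂ] H} (hD : IsSkew D) : IsSA (overI D) := by
  refine ⟨hD.dense, fun x y => ?_, fun x z h => ?_⟩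
  · rw [overI_apply, overI_apply, inner_smul_left, inner_smul_right]
    erw [hD.skew x y]
    simp
  · obtain ⟨h1, h2⟩ := hD.maximal x (Complex.I • z) fun y => by
      have : inner ℂ x ((1 / Complex.I) • D y) = inner ℂ z (y : H) := h y
      rw [inner_smul_right] at this
      have h3 : inner ℂ x (D y) = Complex.I * inner ℂ z (y : H) := by
        rw [← this, ← mul_assoc]
        simp
      rw [h3, inner_smul_left]
      simp
    refine ⟨h1, ?_⟩
    rw [overI_apply]
    erw [h2]
    rw [smul_smul]
    simp

/-- A lower bound for `A - z`. -/
def IsBelow (A : H →ₗ.[ℂ] H) (z : ℂ) (c : ℝ) : Prop :=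
  ∀ x : A.domain, c * ‖(x : H)‖ ≤ ‖A x - z • (x : H)‖

theorem IsResolventAt.unique {A : H →ₗ.[ℂ] H} {z : ℂ} {R S : H →L[ℂ] H}
    (hR : IsResolventAt A z R) (hS : IsResolventAt A z S) : R = S := by
  ext x
  obtain ⟨h, hx⟩ := hS.1 x
  conv_lhs => rw [← hx]
  exact hR.2 ⟨S x, h⟩

/-- To be a resolvent it is enough to be a right inverse of an injective operator. -/
theorem isResolventAt_of_right {A : H →ₗ.[ℂ] H} {z : ℂ} {c : ℝ} (hc : 0 < c)
    (hA : IsBelow A z c) {R : H →L[ℂ] H}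
    (hR : ∀ x : H, ∃ h : R x ∈ A.domain, A ⟨R x, h⟩ - z • R x = x) : IsResolventAt A z R := by
  refine ⟨hR, fun y => ?_⟩
  obtain ⟨h, hx⟩ := hR (A y - z • (y : H))
  have h1 := hA (⟨_, h⟩ - y)
  rw [A.map_sub] at h1
  have h2 : A ⟨_, h⟩ - A y - z • (((⟨_, h⟩ - y : A.domain)) : H) = 0 := by
    rw [AddSubgroupClass.coe_sub, smul_sub, sub_sub_sub_comm, hx, sub_self]
  rw [h2, norm_zero] at h1
  have h3 : ‖(((⟨_, h⟩ - y : A.domain)) : H)‖ = 0 := by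
    by_contra hne
    have := mul_pos hc (lt_of_le_of_ne (norm_nonneg _) (Ne.symm hne))
    linarith
  exact sub_eq_zero.1 (norm_eq_zero.1 h3)

theorem IsResolventAt.isBelow {A : H →ₗ.[ℂ] H} {z : ℂ} {R : H →L[ℂ] H}
    (hR : IsResolventAt A z R) : ∃ c : ℝ, 0 < c ∧ IsBelow A z c := by
  refine ⟨(‖R‖ + 1)⁻¹, by positivity, fun x => ?_⟩
  rw [inv_mul_le_iff₀ (by positivity)]
  calc ‖(x : H)‖ = ‖R (A x - z • (x : H))‖ := by rw [hR.2]
    _ ≤ ‖R‖ * ‖A x - z • (x : H)‖ := R.le_opNorm _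
    _ ≤ _ := by gcongr; linarith

theorem IsResolventAt.norm_le {A : H →ₗ.[ℂ] H} {z : ℂ} {R : H →L[ℂ] H} {c : ℝ}
    (hR : IsResolventAt A z R) (hc : 0 < c) (h : IsBelow A z c) : ‖R‖ ≤ c⁻¹ := by
  refine R.opNorm_le_bound (by positivity) fun x => ?_
  obtain ⟨h1, h2⟩ := hR.1 x
  have := h ⟨R x, h1⟩
  rw [h2] at this
  rw [inv_mul_eq_div, le_div_iff₀ hc, mul_comm]
  exact this

theorem IsSA.inner_self_im {A : H →ₗ.[ℂ] H} (hA : IsSA A) (x : A.domain) :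
    (inner ℂ (A x) (x : H)).im = 0 := by
  have h := hA.symm x x
  rw [← inner_conj_symm (x : H) (A x)] at h
  have := congrArg Complex.im h
  rw [Complex.conj_im] at this
  linarith

/-- Since ⟨(A − Re z)x, x⟩ is real, the cross term with i·(Im z)·x has real part zero. This
Pythagorean identity yields the bound |Im z|, the symmetry under z ↦ z̄, and later the bound
(a²+s²)^(1/2) on the imaginary axis. -/
theorem IsSA.norm_sub_smul_sq {A : H →ₗ.[ℂ] H} (hA : IsSA A) (z : ℂ) (x : A.domain) :
    ‖A x - z • (x : H)‖ ^ 2 = ‖A x - (z.re : ℂ) • (x : H)‖ ^ 2 + z.im ^ 2 * ‖(x : H)‖ ^ 2 := by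
  have h1 : A x - z • (x : H) = (A x - (z.re : ℂ) • (x : H)) - (z.im * Complex.I) • (x : H) := by
    conv_lhs => rw [← Complex.re_add_im z]
    rw [add_smul]
    abel
  have h2 : (inner ℂ (A x - (z.re : ℂ) • (x : H)) (((z.im : ℂ) * Complex.I) • (x : H))).re = 0 := by
    rw [inner_smul_right, inner_sub_left, inner_smul_left]
    have h3 := hA.inner_self_im x
    have h4 : (inner ℂ (x : H) (x : H)).im = 0 := _root_.inner_self_im (𝕜 := ℂ) (x : H)
    simp only [Complex.conj_ofReal, Complex.mul_re, Complex.mul_im, Complex.sub_im, Complex.sub_re,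
      Complex.I_re, Complex.I_im, Complex.ofReal_re, Complex.ofReal_im, h3, h4]
    ring
  have h5 := @norm_sub_sq ℂ _ _ _ _ (A x - (z.re : ℂ) • (x : H)) (((z.im : ℂ) * Complex.I) • (x : H))
  rw [RCLike.re_eq_complex_re, h2] at h5
  rw [h1, h5, norm_smul]
  simp [mul_pow]

theorem IsSA.isBelow_im {A : H →ₗ.[ℂ] H} (hA : IsSA A) (z : ℂ) : IsBelow A z |z.im| := by
  intro x
  rw [← sq_le_sq₀ (by positivity) (norm_nonneg _), hA.norm_sub_smul_sq, mul_pow, sq_abs]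
  nlinarith [sq_nonneg ‖A x - (z.re : ℂ) • (x : H)‖]

theorem IsSA.isBelow_conj {A : H →ₗ.[ℂ] H} (hA : IsSA A) {z : ℂ} {c : ℝ} (hz : IsBelow A z c) :
    IsBelow A (starRingEnd ℂ z) c := by
  intro x
  refine (hz x).trans_eq ?_
  rw [← sq_eq_sq₀ (norm_nonneg _) (norm_nonneg _), hA.norm_sub_smul_sq z,
    hA.norm_sub_smul_sq (starRingEnd ℂ z)]
  simp

/-- The lower bound makes A − z injective with closed range; the orthogonal complement of the range
is the kernel of A − z̄, which the same lower bound at z̄ annihilates. -/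
theorem IsSA.exists_resolvent [CompleteSpace H] {A : H →ₗ.[ℂ] H} (hA : IsSA A) {z : ℂ} {c : ℝ}
    (hc : 0 < c) (hz : IsBelow A z c) : ∃ R : H →L[ℂ] H, IsResolventAt A z R := by
  let L : A.domain →ₗ[ℂ] H := A.toFun - z • A.domain.subtype
  have hL : ∀ x : A.domain, L x = A x - z • (x : H) := fun x => rfl
  have hb : ∀ x : A.domain, c * ‖(x : H)‖ ≤ ‖L x‖ := fun x => by rw [hL]; exact hz x
  have hinj : Function.Injective L := by
    rw [injective_iff_map_eq_zero]
    intro x hx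
    have := hb x
    rw [hx, norm_zero] at this
    have h0 : ‖(x : H)‖ = 0 := by
      by_contra hne
      have := mul_pos hc (lt_of_le_of_ne (norm_nonneg _) (Ne.symm hne))
      linarith
    exact Subtype.ext (norm_eq_zero.1 h0)
  have hclosed : IsClosed (LinearMap.range L : Set H) := by
    refine isClosed_of_closure_subset fun y hy => ?_
    obtain ⟨u, hu, huy⟩ := mem_closure_iff_seq_limit.1 hy
    choose v hv using hu
    have hcau : CauchySeq fun n => (v n : H) := by
      rw [Metric.cauchySeq_iff']
      intro ε hε
      obtain ⟨N, hN⟩ := Metric.cauchySeq_iff'.1 huy.cauchySeq (c * ε) (by positivity)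
      refine ⟨N, fun n hn => ?_⟩
      have h1 := hb (v n - v N)
      have h2 := hN n hn
      rw [map_sub, hv, hv, AddSubgroupClass.coe_sub, ← dist_eq_norm, ← dist_eq_norm] at h1
      exact lt_of_mul_lt_mul_left (h1.trans_lt h2) hc.le
    obtain ⟨x, hx⟩ := cauchySeq_tendsto_of_complete hcau
    have hAv : Filter.Tendsto (fun n => A (v n)) Filter.atTop (nhds (y + z • x)) := by
      have : (fun n => A (v n)) = fun n => u n + z • (v n : H) := by
        ext n
        rw [← hv, hL]
        abel
      rw [this]
      exact huy.add (hx.const_smul z)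
    -- Maximality makes A closed: the symmetry relation for `v n` passes to the limit.
    obtain ⟨h1, h2⟩ := hA.maximal x (y + z • x) fun w => by
      refine tendsto_nhds_unique (f := fun n => inner ℂ (v n : H) (A w))
        (hx.inner tendsto_const_nhds) ?_
      simp_rw [← hA.symm]
      exact hAv.inner tendsto_const_nhds
    exact ⟨⟨x, h1⟩, by rw [hL, h2]; simp⟩
  have hcompl : IsComplete (LinearMap.range L : Set H) := hclosed.isComplete
  have hsurj : LinearMap.range L = ⊤ := by
    have : CompleteSpace (LinearMap.range L) := completeSpace_coe_iff_isComplete.2 hcompl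
    rw [← Submodule.orthogonal_eq_bot_iff, Submodule.eq_bot_iff]
    intro y hy
    rw [Submodule.mem_orthogonal'] at hy
    obtain ⟨h1, h2⟩ := hA.maximal y (starRingEnd ℂ z • y) fun w => by
      have := hy (L w) ⟨w, rfl⟩
      rw [hL, inner_sub_right, inner_smul_right, sub_eq_zero] at this
      rw [this, inner_smul_left, Complex.conj_conj]
    have h3 := hA.isBelow_conj hz ⟨y, h1⟩
    rw [h2, sub_self, norm_zero] at h3
    have h0 : ‖y‖ = 0 := by
      by_contra hne
      have := mul_pos hc (lt_of_le_of_ne (norm_nonneg _) (Ne.symm hne))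
      linarith
    exact norm_eq_zero.1 h0
  let e := LinearEquiv.ofBijective L ⟨hinj, LinearMap.range_eq_top.1 hsurj⟩
  let R : H →L[ℂ] H := (A.domain.subtype ∘ₗ e.symm.toLinearMap).mkContinuous c⁻¹ fun x => by
    have := hb (e.symm x)
    have h2 : L (e.symm x) = x := e.apply_symm_apply x
    rw [h2] at this
    rw [inv_mul_eq_div, le_div_iff₀ hc, mul_comm]
    exact this
  refine ⟨R, fun x => ⟨(e.symm x).2, ?_⟩, fun y => ?_⟩
  · exact e.apply_symm_apply x
  · exact congrArg Subtype.val (e.symm_apply_apply y)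

theorem IsSA.exists_resolvent_of_im_ne [CompleteSpace H] {A : H →ₗ.[ℂ] H} (hA : IsSA A) {z : ℂ}
    (hz : z.im ≠ 0) : ∃ R : H →L[ℂ] H, IsResolventAt A z R :=
  hA.exists_resolvent (abs_pos.2 hz) (hA.isBelow_im z)

end SelfAdjoint

end SkewFredholm

namespace SkewFredholm

/-! ### Scalar spectral measures of a bounded normal operator -/

section NormalMeasure

open MeasureTheory CompactlySupported

variable {H : Type*} [NormedAddCommGroup H] [InnerProductSpace ℂ H] [CompleteSpace H]

theorem inner_cfc_self {N : H →L[ℂ] H} (_hN : IsStarNormal N) {g : ℂ → ℂ}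
    (hg : ContinuousOn g (spectrum ℂ N)) (x : H) :
    inner ℂ x (cfc (fun w => star (g w) * g w) N x) = (‖cfc g N x‖ : ℂ) ^ 2 := by
  rw [cfc_mul (fun w => star (g w)) g N hg.star hg, cfc_star, mul_apply_eq_comp,
    ContinuousLinearMap.star_eq_adjoint, ContinuousLinearMap.adjoint_inner_right,
    inner_self_eq_norm_sq_to_K]
  rfl

/-- The scalar spectral measure of a bounded normal operator at a vector. -/
theorem exists_measure_inner_cfc {N : H →L[ℂ] H} (hN : IsStarNormal N) (x : H) :
    ∃ ν : Measure (spectrum ℂ N), IsFiniteMeasure ν ∧ ∀ g : ℂ → ℂ, ContinuousOn g (spectrum ℂ N) →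
      inner ℂ x (cfc g N x) = ∫ w : spectrum ℂ N, g w ∂ν := by
  let X := spectrum ℂ N
  have : CompactSpace X := isCompact_iff_compactSpace.1 (spectrum.isCompact N)
  let ι : C_c(X, ℝ) → C(X, ℂ) := fun f => ⟨fun w => (f w : ℂ), by fun_prop⟩
  let Φ := cfcHom (R := ℂ) hN
  have hΦ : ∀ (g : ℂ → ℂ) (hg : ContinuousOn g (spectrum ℂ N)),
      cfc g N = Φ ⟨_, hg.domRestrict⟩ := fun g hg => cfc_apply g N hN hg
  have hpos : ∀ f : C_c(X, ℝ), 0 ≤ f → 0 ≤ (inner ℂ x (Φ (ι f) x)).re := by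
    intro f hf
    -- With k the square root of f, the operator of f is V*V for V the operator of k, so its
    -- quadratic form is nonnegative.
    let k : C(X, ℂ) := ⟨fun w => (Real.sqrt (f w) : ℂ), by fun_prop⟩
    have hk : ι f = star k * k := by
      ext w
      have h0 : 0 ≤ f w := hf w
      simp only [ι, k, ContinuousMap.coe_mk, ContinuousMap.mul_apply, ContinuousMap.star_apply]
      rw [Complex.star_def, Complex.conj_ofReal, ← Complex.ofReal_mul, Real.mul_self_sqrt h0]
    rw [hk, map_mul, map_star, mul_apply_eq_comp, ContinuousLinearMap.star_eq_adjoint,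
      ContinuousLinearMap.adjoint_inner_right]
    exact inner_self_nonneg (𝕜 := ℂ)
  let Λ₀ : C_c(X, ℝ) →ₗ[ℝ] ℝ :=
    { toFun := fun f => (inner ℂ x (Φ (ι f) x)).re
      map_add' := fun f g => by
        have : ι (f + g) = ι f + ι g := by
          ext w
          simp [ι]
        rw [this, map_add, add_apply, inner_add_right, Complex.add_re]
      map_smul' := fun c f => by
        have : ι (c • f) = (c : ℂ) • ι f := by
          ext w
          simp [ι]
        rw [this, map_smul, smul_apply, inner_smul_right, Complex.re_ofReal_mul]
        rfl }
  let Λ : C_c(X, ℝ) →ₚ[ℝ] ℝ := PositiveLinearMap.mk₀ Λ₀ hpos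
  let ν := RealRMK.rieszMeasure Λ
  have hfin : IsFiniteMeasure ν := by
    constructor
    exact isCompact_univ.measure_lt_top
  have hreal : ∀ f : C_c(X, ℝ), inner ℂ x (Φ (ι f) x) = ((∫ w, f w ∂ν : ℝ) : ℂ) := by
    intro f
    rw [RealRMK.integral_rieszMeasure Λ f]
    have hsa : ContinuousLinearMap.adjoint (Φ (ι f)) = Φ (ι f) := by
      rw [← ContinuousLinearMap.star_eq_adjoint, ← map_star]
      congr 1
      ext w
      simp [ι]
    refine Complex.ext rfl ?_
    rw [Complex.ofReal_im]
    have h1 : inner ℂ x (Φ (ι f) x) = starRingEnd ℂ (inner ℂ x (Φ (ι f) x)) := by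
      rw [inner_conj_symm, ← ContinuousLinearMap.adjoint_inner_right, hsa]
    have h2 := congrArg Complex.im h1
    rw [Complex.conj_im] at h2
    linarith
  refine ⟨ν, hfin, fun g hg => ?_⟩
  let u : C(X, ℂ) := ⟨_, hg.domRestrict⟩
  let e := (CompactlySupportedContinuousMap.continuousMapEquiv (α := X) (β := ℝ))
  let ur : C_c(X, ℝ) := e ⟨fun w => (u w).re, by fun_prop⟩
  let ui : C_c(X, ℝ) := e ⟨fun w => (u w).im, by fun_prop⟩
  have hu : u = ι ur + Complex.I • ι ui := by
    ext w
    change u w = ((u w).re : ℂ) + Complex.I * ((u w).im : ℂ)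
    rw [mul_comm, Complex.re_add_im]
  have hint : Integrable (fun w : X => g w) ν :=
    (u.continuous.integrable_of_hasCompactSupport
      (HasCompactSupport.of_compactSpace _))
  rw [hΦ g hg, show (⟨_, hg.domRestrict⟩ : C(X, ℂ)) = u from rfl, hu, map_add, map_smul,
    add_apply, smul_apply, inner_add_right,
    inner_smul_right, hreal, hreal]
  rw [← integral_re_add_im hint, mul_comm]
  rfl

variable {N : H →L[ℂ] H}

/-- The scalar spectral measure of a bounded normal operator at a vector. -/
noncomputable def nu (hN : IsStarNormal N) (x : H) : Measure (spectrum ℂ N) := (exists_measure_inner_cfc hN x).choose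

instance (hN : IsStarNormal N) (x : H) : IsFiniteMeasure (nu hN x) := (exists_measure_inner_cfc hN x).choose_spec.1

theorem inner_cfc (hN : IsStarNormal N) (x : H) {g : ℂ → ℂ} (hg : ContinuousOn g (spectrum ℂ N)) :
    inner ℂ x (cfc g N x) = ∫ w : spectrum ℂ N, g w ∂(nu hN x) :=
  (exists_measure_inner_cfc hN x).choose_spec.2 g hg

theorem integrable_nu (hN : IsStarNormal N) (x : H) {E : Type*} [NormedAddCommGroup E] {g : ℂ → E}
    (hg : ContinuousOn g (spectrum ℂ N)) :
    Integrable (fun w : spectrum ℂ N => g w) (nu hN x) := by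
  have : CompactSpace (spectrum ℂ N) := isCompact_iff_compactSpace.1 (spectrum.isCompact N)
  exact (continuousOn_iff_continuous_domRestrict.1 hg).integrable_of_hasCompactSupport
    (HasCompactSupport.of_compactSpace _)

theorem norm_cfc_sq (hN : IsStarNormal N) (x : H) {g : ℂ → ℂ} (hg : ContinuousOn g (spectrum ℂ N)) :
    ‖cfc g N x‖ ^ 2 = ∫ w : spectrum ℂ N, ‖g w‖ ^ 2 ∂(nu hN x) := by
  have h := inner_cfc_self hN hg x
  rw [inner_cfc hN x (by fun_prop)] at h
  have h2 : ∀ w : spectrum ℂ N, star (g w) * g w = ((‖g w‖ ^ 2 : ℝ) : ℂ) := fun w => by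
    rw [Complex.star_def, Complex.conj_mul']
    push_cast
    rfl
  simp_rw [h2] at h
  rw [integral_complex_ofReal] at h
  exact_mod_cast h.symm

/-- Both squared norms are integrals against the same measure. Later operator inequalities on A are
reduced through this to pointwise inequalities between symbols. -/
theorem norm_cfc_apply_le (hN : IsStarNormal N) {f g : ℂ → ℂ} (hf : ContinuousOn f (spectrum ℂ N))
    (hg : ContinuousOn g (spectrum ℂ N)) (h : ∀ w ∈ spectrum ℂ N, ‖f w‖ ≤ ‖g w‖) (x : H) :
    ‖cfc f N x‖ ≤ ‖cfc g N x‖ := by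
  rw [← sq_le_sq₀ (norm_nonneg _) (norm_nonneg _), norm_cfc_sq hN x hf, norm_cfc_sq hN x hg]
  refine integral_mono (integrable_nu hN x (g := fun w => ‖f w‖ ^ 2) (by fun_prop))
    (integrable_nu hN x (g := fun w => ‖g w‖ ^ 2) (by fun_prop)) fun w => ?_
  have := h w w.2
  dsimp only
  gcongr

end NormalMeasure

end SkewFredholm

namespace SkewFredholm

/-! ### From the resolvent at i to spectral measures and the sign -/

section Resolvent

variable {H : Type*} [NormedAddCommGroup H] [InnerProductSpace ℂ H]

/-- The first resolvent identity: apply R to (A − z)Sx = x + (w − z)Sx. -/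
theorem IsResolventAt.sub_eq {A : H →ₗ.[ℂ] H} {z w : ℂ} {R S : H →L[ℂ] H}
    (hR : IsResolventAt A z R) (hS : IsResolventAt A w S) : R - S = (z - w) • (R * S) := by
  ext x
  obtain ⟨h, hx⟩ := hS.1 x
  have h1 := hR.2 ⟨S x, h⟩
  rw [sub_eq_iff_eq_add.1 hx] at h1
  simp only [map_sub, map_add, map_smul] at h1
  simp only [sub_apply, smul_apply, mul_apply_eq_comp, sub_smul]
  rw [sub_eq_iff_eq_add] at h1
  rw [eq_sub_of_add_eq h1]
  abel

variable [CompleteSpace H]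

theorem IsSA.adjoint_resolvent {A : H →ₗ.[ℂ] H} (hA : IsSA A) {z : ℂ} {R S : H →L[ℂ] H}
    (hR : IsResolventAt A z R) (hS : IsResolventAt A (starRingEnd ℂ z) S) :
    ContinuousLinearMap.adjoint R = S := by
  symm
  rw [ContinuousLinearMap.eq_adjoint_iff]
  intro x y
  obtain ⟨h1, hx⟩ := hS.1 x
  obtain ⟨h2, hy⟩ := hR.1 y
  have h3 := hA.symm ⟨S x, h1⟩ ⟨R y, h2⟩
  conv_lhs => rw [← hy]
  conv_rhs => rw [← hx]
  rw [inner_sub_left, inner_sub_right, h3, inner_smul_left, inner_smul_right, Complex.conj_conj]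

theorem resolvent_mul_comm {H : Type*} [NormedAddCommGroup H] [InnerProductSpace ℂ H] {A : H →ₗ.[ℂ] H} {z w : ℂ} {R S : H →L[ℂ] H}
    (hR : IsResolventAt A z R) (hS : IsResolventAt A w S) : R * S = S * R := by
  rcases eq_or_ne z w with rfl | hne
  · rw [hR.unique hS]
  · have h1 := hR.sub_eq hS
    have h2 := hS.sub_eq hR
    rw [← neg_sub, h1, ← neg_smul, neg_sub] at h2
    have h3 : (w - z) • (R * S) = (w - z) • (S * R) := h2
    exact smul_right_injective _ (sub_ne_zero.2 hne.symm) h3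

/-- The inverse Cayley-type coordinate: `t` is recovered from `w = (t - i)⁻¹`. -/
noncomputable def coord (w : ℂ) : ℝ := (w⁻¹).re

theorem measurable_sign : Measurable Real.sign := by
  refine Measurable.ite measurableSet_Iio measurable_const ?_
  exact Measurable.ite measurableSet_Ioi measurable_const measurable_const

theorem measurable_coord : Measurable coord := Complex.measurable_re.comp measurable_inv

/-- w⁻¹ is conj w divided by |w|², so it has the same sign of real part. The sign of t thus becomes
the sign of Re w, a pointwise limit of functions continuous in w. -/
theorem sign_coord (w : ℂ) : Real.sign (coord w) = Real.sign w.re := by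
  rcases eq_or_ne w 0 with rfl | hw
  · simp [coord]
  · have h : 0 < Complex.normSq w := Complex.normSq_pos.2 hw
    rw [coord, Complex.inv_re]
    rcases lt_trichotomy w.re 0 with h1 | h1 | h1
    · rw [Real.sign_of_neg h1, Real.sign_of_neg (div_neg_of_neg_of_pos h1 h)]
    · rw [h1, zero_div]
    · rw [Real.sign_of_pos h1, Real.sign_of_pos (div_pos h1 h)]

variable {A : H →ₗ.[ℂ] H} {N : H →L[ℂ] H}

theorem IsSA.sub_adjoint (hA : IsSA A) (hN : IsResolventAt A Complex.I N) :
    N - star N = (2 * Complex.I) • (N * star N) ∧ N * star N = star N * N := by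
  obtain ⟨S, hS⟩ := hA.exists_resolvent_of_im_ne (z := starRingEnd ℂ Complex.I) (by simp)
  rw [ContinuousLinearMap.star_eq_adjoint, hA.adjoint_resolvent hN hS]
  refine ⟨?_, resolvent_mul_comm hN hS⟩
  rw [hN.sub_eq hS, Complex.conj_I, sub_neg_eq_add, two_mul]

theorem IsSA.isStarNormal (hA : IsSA A) (hN : IsResolventAt A Complex.I N) : IsStarNormal N :=
  ⟨(hA.sub_adjoint hN).2.symm⟩

/-- The resolvent identity between i and −i gives N − N* = 2i·N·N*; read on symbols, the spectrum of
N lies on the circle Im w = |w|², the image of the line under t ↦ (t−i)⁻¹ together with 0. -/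
theorem IsSA.mem_spectrum (hA : IsSA A) (hN : IsResolventAt A Complex.I N) {w : ℂ}
    (hw : w ∈ spectrum ℂ N) : w - star w = (2 * Complex.I) * (w * star w) := by
  have hn := hA.isStarNormal hN
  have h : cfc (fun w : ℂ => w - star w) N = cfc (fun w : ℂ => (2 * Complex.I) * (w * star w)) N := by
    rw [cfc_sub (fun w : ℂ => w) (fun w => star w) N, cfc_const_mul (2 * Complex.I) (fun w => w * star w) N,
      cfc_mul (fun w : ℂ => w) (fun w => star w) N, cfc_id' ℂ N, cfc_star_id (R := ℂ) N]
    exact (hA.sub_adjoint hN).1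
  exact eqOn_of_cfc_eq_cfc h (by fun_prop) (by fun_prop) hn hw

theorem IsSA.inv_eq_coord (hA : IsSA A) (hN : IsResolventAt A Complex.I N) {w : ℂ}
    (hw : w ∈ spectrum ℂ N) (h0 : w ≠ 0) : w⁻¹ = coord w - Complex.I := by
  have h := congrArg Complex.im (hA.mem_spectrum hN hw)
  have h1 : Complex.normSq w ≠ 0 := (Complex.normSq_pos.2 h0).ne'
  have h2 : w.im = Complex.normSq w := by
    rw [Complex.star_def, Complex.mul_conj] at h
    simp at h
    linarith
  apply Complex.ext
  · simp [coord]
  · rw [Complex.inv_im, h2, neg_div, div_self h1]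
    simp

/-- The dictionary between w and t: 1 + (i−z)w is the symbol of (A−z)N, which for w = (t−i)⁻¹ equals
w(t−z). -/
theorem IsSA.one_add_eq (hA : IsSA A) (hN : IsResolventAt A Complex.I N) {w : ℂ}
    (hw : w ∈ spectrum ℂ N) (h0 : w ≠ 0) (z : ℂ) :
    1 + (Complex.I - z) * w = w * (coord w - z) := by
  have := hA.inv_eq_coord hN hw h0
  have h1 : (coord w : ℂ) = w⁻¹ + Complex.I := by rw [this]; ring
  rw [h1]
  field_simp
  ring

theorem IsSA.one_add_ne_zero (hA : IsSA A) (hN : IsResolventAt A Complex.I N) {w : ℂ}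
    (hw : w ∈ spectrum ℂ N) {z : ℂ} (hz : z.im ≠ 0) : 1 + (Complex.I - z) * w ≠ 0 := by
  rcases eq_or_ne w 0 with rfl | h0
  · simp
  · rw [hA.one_add_eq hN hw h0]
    refine mul_ne_zero h0 fun h => hz ?_
    have := congrArg Complex.im h
    simpa using this

/-- The operator `A - z` on the range of the resolvent, in terms of the functional calculus. -/
theorem IsSA.apply_resolvent_cfc (hA : IsSA A) (hN : IsResolventAt A Complex.I N) {k : ℂ → ℂ}
    (hk : ContinuousOn k (spectrum ℂ N)) (z : ℂ) (x : H) :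
    ∃ h : cfc (fun w => w * k w) N x ∈ A.domain,
      A ⟨_, h⟩ - z • cfc (fun w => w * k w) N x =
        cfc (fun w => (1 + (Complex.I - z) * w) * k w) N x := by
  have hn := hA.isStarNormal hN
  have h1 : cfc (fun w => w * k w) N x = N (cfc k N x) := by
    rw [cfc_mul (fun w => w) k N, cfc_id' ℂ N]
    rfl
  obtain ⟨h2, h3⟩ := hN.1 (cfc k N x)
  have h4 : cfc (fun w => (1 + (Complex.I - z) * w) * k w) N x =
      cfc k N x + (Complex.I - z) • N (cfc k N x) := by
    rw [cfc_mul (fun w => 1 + (Complex.I - z) * w) k N,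
      cfc_const_add (1 : ℂ) (fun w => (Complex.I - z) * w) N, cfc_const_mul_id (Complex.I - z) N, map_one]
    simp [mul_apply_eq_comp]
  have h5 : ∀ (y : H) (_ : y = N (cfc k N x)) (h : y ∈ A.domain),
      A ⟨y, h⟩ - z • y = cfc k N x + (Complex.I - z) • N (cfc k N x) := by
    rintro y rfl h
    have h6 := sub_eq_iff_eq_add.1 h3
    rw [h6, sub_smul]
    abel
  rw [h4]
  exact ⟨h1 ▸ h2, h5 _ h1 _⟩

theorem IsSA.isResolventAt_cfc (hA : IsSA A) (hN : IsResolventAt A Complex.I N) {z : ℂ}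
    (hz : z.im ≠ 0) :
    IsResolventAt A z (cfc (fun w => w * (1 + (Complex.I - z) * w)⁻¹) N) := by
  have hn := hA.isStarNormal hN
  refine isResolventAt_of_right (abs_pos.2 hz) (hA.isBelow_im z) fun x => ?_
  have hk : ContinuousOn (fun w : ℂ => (1 + (Complex.I - z) * w)⁻¹) (spectrum ℂ N) :=
    ContinuousOn.inv₀ (by fun_prop) fun w hw => hA.one_add_ne_zero hN hw hz
  obtain ⟨h, h1⟩ := hA.apply_resolvent_cfc hN hk z x
  refine ⟨h, h1.trans ?_⟩
  have h2 : cfc (fun w => (1 + (Complex.I - z) * w) * (1 + (Complex.I - z) * w)⁻¹) N =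
      cfc (fun _ : ℂ => (1 : ℂ)) N :=
    cfc_congr fun w hw => mul_inv_cancel₀ (hA.one_add_ne_zero hN hw hz)
  rw [h2, cfc_const_one ℂ N]
  rfl

open MeasureTheory Filter Topology

/-- The spectral measures do not charge the point `0`, which corresponds to `t = ∞`. -/
theorem IsSA.ae_ne_zero (hA : IsSA A) (hN : IsResolventAt A Complex.I N) (x : H) :
    ∀ᵐ w : spectrum ℂ N ∂(nu (hA.isStarNormal hN) x), (w : ℂ) ≠ 0 := by
  have hn := hA.isStarNormal hN
  -- These functions equal 1 at w = 0, have modulus at most 1, and satisfy |g n w · w| ≤ 1/(n+1):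
  -- they dominate the indicator of {0} but become small on the range of N.
  let g : ℕ → ℂ → ℂ := fun n w => ((1 + (n + 1) * ‖w‖)⁻¹ : ℝ)
  have hpos : ∀ (n : ℕ) (w : ℂ), 0 < 1 + ((n : ℝ) + 1) * ‖w‖ := fun n w => by positivity
  have hgc : ∀ n, Continuous (g n) := fun n =>
    Complex.continuous_ofReal.comp (Continuous.inv₀ (by fun_prop) fun w => (hpos n w).ne')
  have hgn : ∀ n w, ‖g n w‖ = (1 + (n + 1) * ‖w‖)⁻¹ := fun n w => by
    simp only [g, Complex.norm_real, Real.norm_eq_abs]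
    rw [abs_of_pos (inv_pos.2 (hpos n w))]
  have hbound : ∀ (u : H) (n : ℕ), ‖cfc (g n) N x‖ ≤ ‖x - N u‖ + ((n : ℝ) + 1)⁻¹ * ‖u‖ := by
    intro u n
    have h1 : cfc (g n) N x = cfc (g n) N (x - N u) + cfc (fun w => g n w * w) N u := by
      rw [cfc_mul (g n) (fun w => w) N (hgc n).continuousOn, cfc_id' ℂ N, map_sub]
      simp [mul_apply_eq_comp]
    have h2 : ‖cfc (g n) N (x - N u)‖ ≤ ‖x - N u‖ := by
      refine (norm_cfc_apply_le hn (g := fun _ => 1) (hgc n).continuousOn (by fun_prop)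
        (fun w _ => ?_) _).trans_eq ?_
      · rw [hgn, norm_one]
        exact inv_le_one_of_one_le₀ (by have := norm_nonneg w; nlinarith [this, n.cast_nonneg (α := ℝ)])
      · rw [cfc_const_one ℂ N]
        rfl
    have h3 : ‖cfc (fun w => g n w * w) N u‖ ≤ ((n : ℝ) + 1)⁻¹ * ‖u‖ := by
      refine (norm_cfc_apply_le hn (g := fun _ => (((n : ℝ) + 1)⁻¹ : ℝ))
        (by have := hgc n; fun_prop) (by fun_prop) (fun w _ => ?_) _).trans_eq ?_
      · rw [norm_mul, hgn, Complex.norm_real, Real.norm_of_nonneg (by positivity),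
          inv_mul_le_iff₀ (hpos n w), ← div_eq_mul_inv, le_div_iff₀ (by positivity)]
        nlinarith [norm_nonneg w]
      · rw [cfc_const _ N, Algebra.algebraMap_eq_smul_one, smul_apply, norm_smul, Complex.norm_real,
          Real.norm_of_nonneg (by positivity)]
        rfl
    rw [h1]
    exact (norm_add_le _ _).trans (add_le_add h2 h3)
  have hE : MeasurableSet {w : spectrum ℂ N | (w : ℂ) = 0} :=
    measurableSet_eq_fun measurable_subtype_coe measurable_const
  have hle : ∀ n, (nu hn x).real {w : spectrum ℂ N | (w : ℂ) = 0} ≤ ‖cfc (g n) N x‖ ^ 2 := by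
    intro n
    rw [norm_cfc_sq hn x (hgc n).continuousOn, ← integral_indicator_one hE]
    have hi := integrable_nu hn x (g := fun w => ‖g n w‖ ^ 2) ((hgc n).norm.pow 2).continuousOn
    refine integral_mono ((integrable_const (1 : ℝ)).indicator hE) hi fun w => ?_
    by_cases hw : (w : ℂ) = 0
    · rw [Set.indicator_of_mem (by exact hw)]
      simp [hgn, hw]
    · rw [Set.indicator_of_notMem (by exact hw)]
      positivity
  have h0 : ∀ ε > 0, (nu hn x).real {w : spectrum ℂ N | (w : ℂ) = 0} ≤ (ε + ε) ^ 2 := by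
    intro ε hε
    -- The domain of A is the range of N, so density of the domain lets x be approximated by N u.
    obtain ⟨y, hy, hxy⟩ := Metric.mem_closure_iff.1 (hA.dense x) ε hε
    let u := A ⟨y, hy⟩ - Complex.I • y
    have hu : N u = y := hN.2 ⟨y, hy⟩
    obtain ⟨n, hn'⟩ := exists_nat_gt (‖u‖ / ε)
    have h1 : ((n : ℝ) + 1)⁻¹ * ‖u‖ ≤ ε := by
      rw [inv_mul_le_iff₀ (by positivity)]
      rw [div_lt_iff₀ hε] at hn'
      nlinarith
    have h2 := hbound u n
    rw [hu, ← dist_eq_norm] at h2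
    refine (hle n).trans ?_
    gcongr
    linarith
  have hzero : (nu hn x).real {w : spectrum ℂ N | (w : ℂ) = 0} = 0 := by
    refine le_antisymm (le_of_forall_pos_le_add fun δ hδ => ?_) measureReal_nonneg
    refine (h0 (Real.sqrt δ / 2) (by positivity)).trans_eq ?_
    rw [add_halves, Real.sq_sqrt hδ.le, zero_add]
  rw [ae_iff]
  simp only [ne_eq, not_not]
  exact (measureReal_eq_zero_iff (measure_ne_top _ _)).1 hzero

/-- The spectral measure of a self-adjoint operator at a vector. -/
noncomputable def mu (hA : IsSA A) (hN : IsResolventAt A Complex.I N) (x : H) : Measure ℝ :=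
  (nu (hA.isStarNormal hN) x).map fun w : spectrum ℂ N => coord w

theorem measurable_coord_subtype {s : Set ℂ} : Measurable fun w : s => coord w :=
  measurable_coord.comp measurable_subtype_coe

theorem isSpectralMeasureAt_mu (hA : IsSA A) (hN : IsResolventAt A Complex.I N) (x : H) :
    IsSpectralMeasureAt A x (mu hA hN x) := by
  have hn := hA.isStarNormal hN
  refine ⟨Measure.isFiniteMeasure_map _ _, fun z hz => ⟨_, hA.isResolventAt_cfc hN hz, ?_⟩⟩
  have hk : ContinuousOn (fun w : ℂ => w * (1 + (Complex.I - z) * w)⁻¹) (spectrum ℂ N) :=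
    continuousOn_id.mul (ContinuousOn.inv₀ (by fun_prop) fun w hw => hA.one_add_ne_zero hN hw hz)
  have hm : Measurable fun t : ℝ => ((t : ℂ) - z)⁻¹ :=
    (Complex.measurable_ofReal.sub_const z).inv
  rw [inner_cfc hn x hk, mu,
    integral_map measurable_coord_subtype.aemeasurable hm.aestronglyMeasurable]
  refine integral_congr_ae ?_
  filter_upwards [hA.ae_ne_zero hN x] with w hw
  rw [hA.one_add_eq hN w.2 hw, mul_inv, ← mul_assoc, mul_inv_cancel₀ hw, one_mul]

/-- A continuous approximation of the sign of the real part. -/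
noncomputable def signApprox (n : ℕ) (w : ℂ) : ℂ := ((n * w.re / (1 + n * |w.re|) : ℝ) : ℂ)

theorem continuous_signApprox (n : ℕ) : Continuous (signApprox n) := by
  refine Complex.continuous_ofReal.comp (Continuous.div (by fun_prop) (by fun_prop) fun w => ?_)
  positivity

theorem norm_signApprox_le (n : ℕ) (w : ℂ) : ‖signApprox n w‖ ≤ 1 := by
  have h : 0 ≤ (n : ℝ) * |w.re| := by positivity
  rw [signApprox, Complex.norm_real, Real.norm_eq_abs, abs_div, abs_mul, Nat.abs_cast,
    abs_of_pos (show 0 < 1 + (n : ℝ) * |w.re| by positivity), div_le_one (by positivity)]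
  linarith

theorem tendsto_signApprox (w : ℂ) :
    Tendsto (fun n => signApprox n w) atTop (𝓝 (Real.sign w.re : ℂ)) := by
  refine (Complex.continuous_ofReal.tendsto _).comp ?_
  rcases eq_or_ne w.re 0 with h | h
  · simp [h]
  · have h1 : Tendsto (fun n : ℕ => ((n : ℝ) * |w.re|)) atTop atTop :=
      tendsto_natCast_atTop_atTop.atTop_mul_const (abs_pos.2 h)
    have h2 : Tendsto (fun n : ℕ => Real.sign w.re * (1 - (1 + (n : ℝ) * |w.re|)⁻¹)) atTop
        (𝓝 (Real.sign w.re * (1 - 0))) :=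
      tendsto_const_nhds.mul (tendsto_const_nhds.sub
        (tendsto_inv_atTop_zero.comp (tendsto_atTop_add_const_left _ 1 h1)))
    rw [sub_zero, mul_one] at h2
    refine h2.congr fun n => ?_
    have h3 : Real.sign w.re * |w.re| = w.re := by
      rcases lt_or_gt_of_ne h with h4 | h4
      · rw [Real.sign_of_neg h4, abs_of_neg h4]; ring
      · rw [Real.sign_of_pos h4, abs_of_pos h4]; ring
    have h5 : 1 + (n : ℝ) * |w.re| ≠ 0 := by positivity
    rw [eq_div_iff h5, mul_assoc, sub_mul, inv_mul_cancel₀ h5]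
    conv_rhs => rw [← h3]
    ring

/-- The operators `cfc (signApprox n) N` converge strongly: their symbols converge in L² of each
measure `nu` by dominated convergence, and `norm_cfc_sq` turns this into a Cauchy sequence at every
vector. The limit is bounded by the uniform boundedness principle. -/
theorem IsSA.exists_isFunctionOf_sign (hA : IsSA A) : ∃ S, IsFunctionOf A Real.sign S := by
  obtain ⟨N, hN⟩ := hA.exists_resolvent_of_im_ne (z := Complex.I) (by simp)
  have hn := hA.isStarNormal hN
  have hsm : Measurable fun w : spectrum ℂ N => (Real.sign (w : ℂ).re : ℂ) :=
    Complex.measurable_ofReal.comp (measurable_sign.comp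
      (Complex.measurable_re.comp measurable_subtype_coe))
  have hsn : ∀ t : ℝ, ‖(Real.sign t : ℂ)‖ ≤ 1 := fun t => by
    rcases Real.sign_apply_eq t with h | h | h <;> simp [h]
  let G : ℕ → H →L[ℂ] H := fun n => cfc (signApprox n) N
  have hL2 : ∀ x, Tendsto (fun n => ∫ w : spectrum ℂ N,
      ‖signApprox n w - (Real.sign (w : ℂ).re : ℂ)‖ ^ 2 ∂(nu hn x)) atTop (𝓝 0) := by
    intro x
    rw [show (0 : ℝ) = ∫ w : spectrum ℂ N, (0 : ℝ) ∂(nu hn x) by simp]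
    -- The constant 4 is (1+1)², both functions having modulus at most 1.
    refine tendsto_integral_of_dominated_convergence (fun _ => 4) (fun n => ?_)
      (integrable_const _) (fun n => ?_) ?_
    · exact (((continuous_signApprox n).measurable.comp measurable_subtype_coe).sub
        hsm).norm.pow_const 2 |>.aestronglyMeasurable
    · refine Eventually.of_forall fun w => ?_
      rw [Real.norm_of_nonneg (by positivity)]
      have := (norm_sub_le (signApprox n w) (Real.sign (w : ℂ).re : ℂ)).trans
        (add_le_add (norm_signApprox_le n w) (hsn _))
      nlinarith [norm_nonneg (signApprox n w - (Real.sign (w : ℂ).re : ℂ))]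
    · refine Eventually.of_forall fun w => ?_
      have h := ((tendsto_signApprox (w : ℂ)).sub_const (Real.sign (w : ℂ).re : ℂ)).norm.pow 2
      simpa using h
  have hI : ∀ x n, Integrable (fun w : spectrum ℂ N =>
      ‖signApprox n w - (Real.sign (w : ℂ).re : ℂ)‖ ^ 2) (nu hn x) := by
    intro x n
    refine Integrable.mono' (integrable_const 4) ?_ (Eventually.of_forall fun w => ?_)
    · exact (((continuous_signApprox n).measurable.comp measurable_subtype_coe).sub
        hsm).norm.pow_const 2 |>.aestronglyMeasurable
    · rw [Real.norm_of_nonneg (by positivity)]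
      have := (norm_sub_le (signApprox n w) (Real.sign (w : ℂ).re : ℂ)).trans
        (add_le_add (norm_signApprox_le n w) (hsn _))
      nlinarith [norm_nonneg (signApprox n w - (Real.sign (w : ℂ).re : ℂ))]
  have hcau : ∀ x, CauchySeq fun n => G n x := by
    intro x
    rw [Metric.cauchySeq_iff]
    intro ε hε
    have hev := (hL2 x).eventually (gt_mem_nhds (show (0 : ℝ) < ε ^ 2 / 4 by positivity))
    obtain ⟨n₀, hn₀⟩ := eventually_atTop.1 hev
    refine ⟨n₀, fun m hm n hn' => ?_⟩
    rw [dist_eq_norm]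
    have h1 : G m x - G n x = cfc (fun w => signApprox m w - signApprox n w) N x := by
      rw [cfc_sub (signApprox m) (signApprox n) N (continuous_signApprox m).continuousOn
        (continuous_signApprox n).continuousOn]
      rfl
    have hc : Continuous fun w => signApprox m w - signApprox n w :=
      (continuous_signApprox m).sub (continuous_signApprox n)
    have h2 : ‖G m x - G n x‖ ^ 2 < ε ^ 2 := by
      rw [h1, norm_cfc_sq hn x hc.continuousOn]
      have h3 : ∫ w : spectrum ℂ N, ‖signApprox m w - signApprox n w‖ ^ 2 ∂(nu hn x) ≤
          ∫ w : spectrum ℂ N, (2 * ‖signApprox m w - (Real.sign (w : ℂ).re : ℂ)‖ ^ 2 +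
            2 * ‖signApprox n w - (Real.sign (w : ℂ).re : ℂ)‖ ^ 2) ∂(nu hn x) := by
        refine integral_mono (integrable_nu hn x
          (g := fun w => ‖signApprox m w - signApprox n w‖ ^ 2) (hc.norm.pow 2).continuousOn)
          (((hI x m).const_mul 2).add ((hI x n).const_mul 2)) fun w => ?_
        have := norm_sub_le_norm_sub_add_norm_sub (signApprox m w) (Real.sign (w : ℂ).re : ℂ)
          (signApprox n w)
        rw [norm_sub_rev (Real.sign (w : ℂ).re : ℂ) (signApprox n w)] at this
        dsimp only
        nlinarith [norm_nonneg (signApprox m w - signApprox n w),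
          sq_nonneg (‖signApprox m w - (Real.sign (w : ℂ).re : ℂ)‖ -
            ‖signApprox n w - (Real.sign (w : ℂ).re : ℂ)‖)]
      rw [integral_add ((hI x m).const_mul 2) ((hI x n).const_mul 2), integral_const_mul,
        integral_const_mul] at h3
      have := hn₀ m hm
      have := hn₀ n hn'
      linarith
    exact lt_of_pow_lt_pow_left₀ 2 hε.le h2
  choose F hF using fun x => cauchySeq_tendsto_of_complete (hcau x)
  refine ⟨continuousLinearMapOfTendsto G (tendsto_pi_nhds.2 hF), fun x =>
    ⟨mu hA hN x, isSpectralMeasureAt_mu hA hN x, ?_⟩⟩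
  have h1 : Tendsto (fun n => inner ℂ x (G n x)) atTop (𝓝 (inner ℂ x (F x))) :=
    tendsto_const_nhds.inner (hF x)
  refine tendsto_nhds_unique h1 ?_
  have hms : Measurable fun t : ℝ => (Real.sign t : ℂ) :=
    Complex.measurable_ofReal.comp measurable_sign
  rw [mu, integral_map measurable_coord_subtype.aemeasurable hms.aestronglyMeasurable]
  simp_rw [sign_coord]
  have h2 : ∀ n, inner ℂ x (G n x) = ∫ w : spectrum ℂ N, signApprox n w ∂(nu hn x) := fun n =>
    inner_cfc hn x (continuous_signApprox n).continuousOn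
  simp_rw [h2]
  exact tendsto_integral_of_dominated_convergence (fun _ => 1)
    (fun n => ((continuous_signApprox n).measurable.comp
      measurable_subtype_coe).aestronglyMeasurable) (integrable_const _)
    (fun n => Eventually.of_forall fun w => norm_signApprox_le n w)
    (Eventually.of_forall fun w => tendsto_signApprox w)

end Resolvent

end SkewFredholm

namespace SkewFredholm

/-! ### The sign as an integral of resolvents along the imaginary axis -/

section IntegralFormula

open MeasureTheory Filter Topology

variable {H : Type*} [NormedAddCommGroup H] [InnerProductSpace ℂ H] [CompleteSpace H]
variable {A : H →ₗ.[ℂ] H}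

open Classical in
/-- The resolvent of `A` at `z`, with value `0` if `z` lies in the spectrum. -/
noncomputable def res {H : Type*} [NormedAddCommGroup H] [InnerProductSpace ℂ H]
    (A : H →ₗ.[ℂ] H) (z : ℂ) : H →L[ℂ] H :=
  if h : ∃ R, IsResolventAt A z R then h.choose else 0

theorem IsResolventAt.eq_res {H : Type*} [NormedAddCommGroup H] [InnerProductSpace ℂ H]
    {A : H →ₗ.[ℂ] H} {z : ℂ} {R : H →L[ℂ] H} (hR : IsResolventAt A z R) : R = res A z := by
  have h : ∃ R, IsResolventAt A z R := ⟨R, hR⟩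
  rw [res, dif_pos h]
  exact hR.unique h.choose_spec

theorem IsSA.isResolventAt_res (hA : IsSA A) {z : ℂ} (hz : z.im ≠ 0) :
    IsResolventAt A z (res A z) := by
  obtain ⟨R, hR⟩ := hA.exists_resolvent_of_im_ne hz
  rwa [← hR.eq_res]

theorem IsSA.norm_res_le (hA : IsSA A) {z : ℂ} (hz : z.im ≠ 0) : ‖res A z‖ ≤ |z.im|⁻¹ :=
  (hA.isResolventAt_res hz).norm_le (abs_pos.2 hz) (hA.isBelow_im z)

/-- The sum of the resolvents at `i s` and `-i s`. -/
noncomputable def resSum {H : Type*} [NormedAddCommGroup H] [InnerProductSpace ℂ H]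
    (A : H →ₗ.[ℂ] H) (s : ℝ) : H →L[ℂ] H :=
  res A (s * Complex.I) + res A (-s * Complex.I)

theorem IsSA.continuousAt_res (hA : IsSA A) {z : ℂ} (hz : z.im ≠ 0) : ContinuousAt (res A) z := by
  rw [ContinuousAt, tendsto_iff_norm_sub_tendsto_zero]
  have h1 : Tendsto (fun w : ℂ => ‖w - z‖ * (|w.im|⁻¹ * |z.im|⁻¹)) (𝓝 z)
      (𝓝 (‖z - z‖ * (|z.im|⁻¹ * |z.im|⁻¹))) := by
    have h2 : ContinuousAt (fun w : ℂ => ‖w - z‖ * (|w.im|⁻¹ * |z.im|⁻¹)) z :=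
      ContinuousAt.mul (by fun_prop) (ContinuousAt.mul (ContinuousAt.inv₀
        (Complex.continuous_im.abs.continuousAt) (abs_pos.2 hz).ne') (by fun_prop))
    exact h2
  rw [sub_self, norm_zero, zero_mul] at h1
  refine squeeze_zero' (Eventually.of_forall fun _ => norm_nonneg _) ?_ h1
  have h3 : ∀ᶠ w : ℂ in 𝓝 z, w.im ≠ 0 := Complex.continuous_im.continuousAt.eventually_ne hz
  filter_upwards [h3] with w hw
  rw [(hA.isResolventAt_res hw).sub_eq (hA.isResolventAt_res hz), norm_smul]
  gcongr
  exact (norm_mul_le _ _).trans (by gcongr <;> apply hA.norm_res_le <;> assumption)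

theorem IsSA.continuousOn_resSum (hA : IsSA A) {a b : ℝ} (ha : 0 < a) (hb : 0 < b) :
    ContinuousOn (resSum A) (Set.uIcc a b) := by
  intro s hs
  have h0 : s ≠ 0 := ((lt_min ha hb).trans_le hs.1).ne'
  refine ContinuousAt.continuousWithinAt (ContinuousAt.add ?_ ?_)
  · exact ContinuousAt.comp (f := fun s : ℝ => (s : ℂ) * Complex.I)
      (hA.continuousAt_res (by simpa using h0)) (by fun_prop)
  · exact ContinuousAt.comp (f := fun s : ℝ => -(s : ℂ) * Complex.I)
      (hA.continuousAt_res (by simpa using h0)) (by fun_prop)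

theorem IsSA.intervalIntegrable_resSum (hA : IsSA A) {a b : ℝ} (ha : 0 < a) (hb : 0 < b) :
    IntervalIntegrable (resSum A) volume a b :=
  (hA.continuousOn_resSum ha hb).intervalIntegrable

/-- The truncated integral of the resolvent along the imaginary axis. -/
noncomputable def truncSign (A : H →ₗ.[ℂ] H) (n : ℕ) : H →L[ℂ] H :=
  (Real.pi : ℂ)⁻¹ • ∫ s in ((n : ℝ) + 1)⁻¹..((n : ℝ) + 1), resSum A s

theorem inv_sub_add_inv_add {s : ℝ} (hs : s ≠ 0) (t : ℝ) :
    ((t : ℂ) - s * Complex.I)⁻¹ + ((t : ℂ) - -s * Complex.I)⁻¹ =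
      ((2 * t / (t ^ 2 + s ^ 2) : ℝ) : ℂ) := by
  have h1 : (t : ℂ) - s * Complex.I ≠ 0 := fun h => hs (by simpa using congrArg Complex.im h)
  have h2 : (t : ℂ) - -s * Complex.I ≠ 0 := fun h => hs (by simpa using congrArg Complex.im h)
  have h3 : (t : ℂ) ^ 2 + (s : ℂ) ^ 2 = (t - s * Complex.I) * (t - -s * Complex.I) := by
    ring_nf
    rw [Complex.I_sq]
    ring
  push_cast
  rw [h3, inv_add_inv h1 h2]
  congr 1
  ring

theorem integral_kernel {a b : ℝ} (ha : 0 < a) (hb : 0 < b) (t : ℝ) :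
    ∫ s in a..b, 2 * t / (t ^ 2 + s ^ 2) = 2 * (Real.arctan (b / t) - Real.arctan (a / t)) := by
  have hpos : ∀ s ∈ Set.uIcc a b, 0 < t ^ 2 + s ^ 2 := fun s hs => by
    have := (lt_min ha hb).trans_le hs.1
    positivity
  rw [mul_sub]
  refine intervalIntegral.integral_eq_sub_of_hasDerivAt (f := fun s => 2 * Real.arctan (s / t))
    (fun s hs => ?_) ?_
  -- For t = 0 the integrand is 0, and the primitive is constant because s / 0 = 0.
  · rcases eq_or_ne t 0 with rfl | ht
    · simpa using hasDerivAt_const s (0 : ℝ)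
    · have h := (((hasDerivAt_id s).div_const t).arctan).const_mul 2
      refine h.congr_deriv ?_
      have := hpos s hs
      simp only [id]
      field_simp
  · refine ContinuousOn.intervalIntegrable (ContinuousOn.div (by fun_prop) (by fun_prop)
      fun s hs => (hpos s hs).ne')

theorem tendsto_arctan_sub (t : ℝ) :
    Tendsto (fun n : ℕ => Real.pi⁻¹ * (2 * (Real.arctan (((n : ℝ) + 1) / t) -
      Real.arctan (((n : ℝ) + 1)⁻¹ / t)))) atTop (𝓝 (Real.sign t)) := by
  have h1 : Tendsto (fun n : ℕ => (n : ℝ) + 1) atTop atTop :=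
    tendsto_atTop_add_const_right _ 1 tendsto_natCast_atTop_atTop
  have h2 : Tendsto (fun n : ℕ => Real.arctan (((n : ℝ) + 1)⁻¹ / t)) atTop (𝓝 0) := by
    have := (Real.continuous_arctan.tendsto (0 / t)).comp
      ((tendsto_inv_atTop_zero.comp h1).div_const t)
    rwa [zero_div, Real.arctan_zero] at this
  have h3 : Tendsto (fun n : ℕ => Real.arctan (((n : ℝ) + 1) / t)) atTop
      (𝓝 (Real.pi / 2 * Real.sign t)) := by
    rcases lt_trichotomy t 0 with h | h | h
    · rw [Real.sign_of_neg h, mul_neg_one]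
      exact (tendsto_nhds_of_tendsto_nhdsWithin Real.tendsto_arctan_atBot).comp
        (h1.atTop_div_const_of_neg h)
    -- At t = 0 the convention x / 0 = 0 makes every term vanish, in agreement with sign 0 = 0.
    · simp [h]
    · rw [Real.sign_of_pos h, mul_one]
      exact (tendsto_nhds_of_tendsto_nhdsWithin Real.tendsto_arctan_atTop).comp
        (h1.atTop_div_const h)
  have h4 := ((h3.sub h2).const_mul 2).const_mul Real.pi⁻¹
  have h5 : Real.pi⁻¹ * (2 * (Real.pi / 2 * Real.sign t - 0)) = Real.sign t := by
    field_simp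
    ring
  rwa [h5] at h4

theorem abs_arctan_sub_le (u v : ℝ) :
    |Real.pi⁻¹ * (2 * (Real.arctan u - Real.arctan v))| ≤ 2 := by
  have h1 := Real.arctan_lt_pi_div_two u
  have h2 := Real.neg_pi_div_two_lt_arctan u
  have h3 := Real.arctan_lt_pi_div_two v
  have h4 := Real.neg_pi_div_two_lt_arctan v
  rw [abs_mul, abs_of_pos (inv_pos.2 Real.pi_pos), inv_mul_le_iff₀ Real.pi_pos, abs_le]
  constructor <;> linarith

theorem IsSpectralMeasureAt.inner_res {H : Type*} [NormedAddCommGroup H] [InnerProductSpace ℂ H]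
    {A : H →ₗ.[ℂ] H} {x : H} {μ : Measure ℝ} (hμ : IsSpectralMeasureAt A x μ)
    {z : ℂ} (hz : z.im ≠ 0) : inner ℂ x (res A z x) = ∫ t : ℝ, ((t : ℂ) - z)⁻¹ ∂μ := by
  obtain ⟨R, hR, h⟩ := hμ.2 z hz
  rw [← hR.eq_res, h]

theorem integrable_inv_sub {μ : Measure ℝ} [IsFiniteMeasure μ] {z : ℂ} (hz : z.im ≠ 0) :
    Integrable (fun t : ℝ => ((t : ℂ) - z)⁻¹) μ := by
  refine Integrable.mono' (integrable_const |z.im|⁻¹)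
    ((Complex.measurable_ofReal.sub_const z).inv).aestronglyMeasurable
    (Eventually.of_forall fun t => ?_)
  rw [norm_inv]
  refine inv_anti₀ (abs_pos.2 hz) ?_
  simpa using Complex.abs_im_le_norm ((t : ℂ) - z)

theorem IsSpectralMeasureAt.inner_resSum {H : Type*} [NormedAddCommGroup H]
    [InnerProductSpace ℂ H] {A : H →ₗ.[ℂ] H} {x : H} {μ : Measure ℝ} (hμ : IsSpectralMeasureAt A x μ)
    {s : ℝ} (hs : s ≠ 0) :
    inner ℂ x (resSum A s x) = ∫ t : ℝ, ((2 * t / (t ^ 2 + s ^ 2) : ℝ) : ℂ) ∂μ := by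
  have := hμ.1
  have h1 : ((s : ℂ) * Complex.I).im ≠ 0 := by simpa using hs
  have h2 : (-(s : ℂ) * Complex.I).im ≠ 0 := by simpa using hs
  rw [resSum, add_apply, inner_add_right, hμ.inner_res h1, hμ.inner_res h2,
    ← integral_add (integrable_inv_sub h1) (integrable_inv_sub h2)]
  simp_rw [inv_sub_add_inv_add hs]

/-- Fubini: the s-integral of the kernel 2t/(t²+s²) is explicit, and on the truncated interval the
kernel is bounded, so it is integrable for the product measure. -/
theorem IsSA.inner_truncSign (hA : IsSA A) {x : H} {μ : Measure ℝ}
    (hμ : IsSpectralMeasureAt A x μ) (n : ℕ) :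
    inner ℂ x (truncSign A n x) = ∫ t : ℝ, ((Real.pi⁻¹ * (2 * (Real.arctan (((n : ℝ) + 1) / t) -
      Real.arctan (((n : ℝ) + 1)⁻¹ / t))) : ℝ) : ℂ) ∂μ := by
  have := hμ.1
  have hb : 0 < (n : ℝ) + 1 := by positivity
  have ha := inv_pos.2 hb
  have h1 : inner ℂ x (truncSign A n x) = (Real.pi : ℂ)⁻¹ *
      ∫ s in ((n : ℝ) + 1)⁻¹..((n : ℝ) + 1), inner ℂ x (resSum A s x) := by
    rw [truncSign, smul_apply, inner_smul_right]
    congr 1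
    let L : (H →L[ℂ] H) →L[ℂ] ℂ := (innerSL ℂ x) ∘L (ContinuousLinearMap.apply ℂ H x)
    exact (L.intervalIntegral_comp_comm (hA.intervalIntegrable_resSum ha hb)).symm
  have h2 : ∫ s in ((n : ℝ) + 1)⁻¹..((n : ℝ) + 1), inner ℂ x (resSum A s x) =
      ∫ s in ((n : ℝ) + 1)⁻¹..((n : ℝ) + 1),
        ∫ t : ℝ, ((2 * t / (t ^ 2 + s ^ 2) : ℝ) : ℂ) ∂μ := by
    refine intervalIntegral.integral_congr fun s hs => ?_
    exact hμ.inner_resSum ((lt_min ha hb).trans_le hs.1).ne'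
  rw [h1, h2, intervalIntegral_integral_swap, ← integral_const_mul]
  · refine integral_congr_ae (Eventually.of_forall fun t => ?_)
    dsimp only
    rw [intervalIntegral.integral_ofReal, integral_kernel ha hb]
    push_cast
    rfl
  · have hfin : IsFiniteMeasure
        (volume.restrict (Set.uIoc ((n : ℝ) + 1)⁻¹ ((n : ℝ) + 1))) :=
      isFiniteMeasure_restrict.2 ((measure_mono Set.uIoc_subset_uIcc).trans_lt
        isCompact_uIcc.measure_lt_top).ne
    refine Integrable.mono' (integrable_const ((n : ℝ) + 1)) ?_ ?_
    · refine Measurable.aestronglyMeasurable ?_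
      refine Complex.measurable_ofReal.comp ?_
      exact (measurable_snd.const_mul 2).div ((measurable_snd.pow_const 2).add
        (measurable_fst.pow_const 2))
    · have h3 : ∀ᵐ s : ℝ ∂(volume.restrict (Set.uIoc ((n : ℝ) + 1)⁻¹ ((n : ℝ) + 1))),
          s ∈ Set.uIoc ((n : ℝ) + 1)⁻¹ ((n : ℝ) + 1) := ae_restrict_mem measurableSet_uIoc
      have h4 := Measure.quasiMeasurePreserving_fst (ν := μ) |>.ae h3
      filter_upwards [h4] with p hp
      have hs : ((n : ℝ) + 1)⁻¹ < p.1 := by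
        refine lt_of_le_of_lt ?_ hp.1
        refine le_min le_rfl ((inv_le_one_of_one_le₀ ?_).trans ?_) <;>
          linarith [n.cast_nonneg (α := ℝ)]
      have hp0 : 0 < p.1 := ha.trans hs
      -- The bound n+1 comes from 2|t|s ≤ t²+s², hence |2t/(t²+s²)| ≤ 1/s ≤ n+1.
      have h5 : 1 ≤ ((n : ℝ) + 1) * p.1 := by
        rw [inv_lt_iff_one_lt_mul₀ hb] at hs
        linarith
      simp only [Function.uncurry, Complex.norm_real, Real.norm_eq_abs]
      rw [abs_div, abs_mul, abs_two, abs_of_pos (show 0 < p.2 ^ 2 + p.1 ^ 2 by positivity),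
        div_le_iff₀ (by positivity), ← sq_abs p.2]
      have h6 : 0 ≤ |p.2| := abs_nonneg _
      nlinarith [sq_nonneg (|p.2| - p.1), mul_nonneg hb.le (sq_nonneg (|p.2| - p.1)),
        mul_le_mul_of_nonneg_left h5 h6]

theorem IsSA.tendsto_inner_truncSign (hA : IsSA A) {x : H} {μ : Measure ℝ}
    (hμ : IsSpectralMeasureAt A x μ) :
    Tendsto (fun n => inner ℂ x (truncSign A n x)) atTop (𝓝 (∫ t : ℝ, (Real.sign t : ℂ) ∂μ)) := by
  have := hμ.1
  simp_rw [hA.inner_truncSign hμ]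
  refine tendsto_integral_of_dominated_convergence (fun _ => 2) (fun n => ?_)
    (integrable_const _) (fun n => Eventually.of_forall fun t => ?_)
    (Eventually.of_forall fun t => (Complex.continuous_ofReal.tendsto _).comp
      (tendsto_arctan_sub t))
  · refine (Complex.measurable_ofReal.comp (Measurable.const_mul (Measurable.const_mul
      (Measurable.sub ?_ ?_) _) _)).aestronglyMeasurable
    · exact Real.continuous_arctan.measurable.comp (measurable_const.div measurable_id)
    · exact Real.continuous_arctan.measurable.comp (measurable_const.div measurable_id)
  · rw [Complex.norm_real]
    exact abs_arctan_sub_le _ _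

/-- Every spectral measure at x gives the integral of the sign as the limit of the same sequence,
built from resolvents. This bypasses the uniqueness of the measure itself. -/
theorem IsSA.inner_signOf (hA : IsSA A) {x : H} {μ : Measure ℝ}
    (hμ : IsSpectralMeasureAt A x μ) {S : H →L[ℂ] H} (hS : IsFunctionOf A Real.sign S) :
    inner ℂ x (S x) = ∫ t : ℝ, (Real.sign t : ℂ) ∂μ := by
  obtain ⟨μ', hμ', h⟩ := hS x
  rw [h]
  exact tendsto_nhds_unique (hA.tendsto_inner_truncSign hμ') (hA.tendsto_inner_truncSign hμ)

theorem IsSA.existsUnique_sign (hA : IsSA A) : ∃! S, IsFunctionOf A Real.sign S := by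
  obtain ⟨S, hS⟩ := hA.exists_isFunctionOf_sign
  refine ⟨S, hS, fun T hT => ?_⟩
  have h : (T : H →ₗ[ℂ] H) = S := by
    rw [← ext_inner_map]
    intro x
    obtain ⟨μ, hμ, h⟩ := hT x
    have h1 := hA.inner_signOf hμ hS
    rw [← h] at h1
    have h2 := congrArg (starRingEnd ℂ) h1
    rw [inner_conj_symm, inner_conj_symm] at h2
    exact h2.symm
  exact ContinuousLinearMap.coe_injective h

theorem IsSA.isFunctionOf_functionOf (hA : IsSA A) :
    IsFunctionOf A Real.sign (functionOf A Real.sign) := by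
  have h := hA.existsUnique_sign.exists
  rw [functionOf, dif_pos h]
  exact h.choose_spec

end IntegralFormula

end SkewFredholm

namespace SkewFredholm

/-! ### Hilbert–Schmidt norms -/

section HilbertSchmidtLemmas

open Filter Topology

variable {𝕜 H : Type*} [RCLike 𝕜] [NormedAddCommGroup H] [InnerProductSpace 𝕜 H] [CompleteSpace H]

theorem isHilbertSchmidt_iff {T : H →L[𝕜] H} : IsHilbertSchmidt T ↔ hsNormSq T < ∞ := by
  rw [IsHilbertSchmidt, hsNorm, ENNReal.rpow_lt_top_iff_of_pos (by norm_num)]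

theorem hsNorm_sq (T : H →L[𝕜] H) : hsNorm T ^ 2 = hsNormSq T := by
  rw [hsNorm, ← ENNReal.rpow_natCast, ← ENNReal.rpow_mul]
  norm_num

theorem hsNorm_le_iff {T : H →L[𝕜] H} {C : ℝ≥0∞} : hsNorm T ≤ C ↔ hsNormSq T ≤ C ^ 2 := by
  rw [← hsNorm_sq, ENNReal.pow_le_pow_left_iff two_ne_zero]

theorem hsNormSq_adjoint (T : H →L[𝕜] H) :
    hsNormSq (ContinuousLinearMap.adjoint T) = hsNormSq T :=
  (tsum_enorm_sq_eq_adjoint (basis 𝕜 H) (basis 𝕜 H) T).symm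

theorem hsNormSq_mul_left_le (L T : H →L[𝕜] H) : hsNormSq (L * T) ≤ ‖L‖ₑ ^ 2 * hsNormSq T := by
  rw [hsNormSq, hsNormSq, ← ENNReal.tsum_mul_left]
  refine ENNReal.tsum_le_tsum fun i => ?_
  rw [← mul_pow]
  gcongr
  exact L.le_opENorm _

theorem hsNormSq_mul_right_le (T L : H →L[𝕜] H) : hsNormSq (T * L) ≤ ‖L‖ₑ ^ 2 * hsNormSq T := by
  rw [← hsNormSq_adjoint (T * L), ← hsNormSq_adjoint T, ← ContinuousLinearMap.star_eq_adjoint,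
    star_mul]
  refine (hsNormSq_mul_left_le _ _).trans_eq ?_
  rw [← ofReal_norm, ContinuousLinearMap.star_eq_adjoint, LinearIsometryEquiv.norm_map,
    ofReal_norm]
  rfl

theorem hsNorm_mul_mul_le (L T R : H →L[𝕜] H) :
    hsNorm (L * T * R) ≤ ‖L‖ₑ * ‖R‖ₑ * hsNorm T := by
  rw [hsNorm_le_iff, mul_pow, hsNorm_sq, mul_pow, mul_comm (‖L‖ₑ ^ 2), mul_assoc]
  exact (hsNormSq_mul_right_le (L * T) R).trans (by
    rw [mul_assoc]
    exact mul_le_mul_right (hsNormSq_mul_left_le L T) _)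

theorem hsNormSq_neg (T : H →L[𝕜] H) : hsNormSq (-T) = hsNormSq T := by
  simp [hsNormSq]

theorem hsNorm_neg (T : H →L[𝕜] H) : hsNorm (-T) = hsNorm T := by
  rw [hsNorm, hsNorm, hsNormSq_neg]

theorem hsNorm_smul_of_norm_one {c : 𝕜} (hc : ‖c‖ = 1) (T : H →L[𝕜] H) :
    hsNorm (c • T) = hsNorm T := by
  have h : ‖c‖ₑ = 1 := by rw [← ofReal_norm, hc, ENNReal.ofReal_one]
  simp [hsNorm, hsNormSq, enorm_smul, h]

theorem IsHilbertSchmidt.add {S T : H →L[𝕜] H} (hS : IsHilbertSchmidt S)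
    (hT : IsHilbertSchmidt T) : IsHilbertSchmidt (S + T) := by
  rw [isHilbertSchmidt_iff] at *
  have h : hsNormSq (S + T) ≤ 2 * (hsNormSq S + hsNormSq T) := by
    rw [hsNormSq, hsNormSq, hsNormSq, ← ENNReal.tsum_add, ← ENNReal.tsum_mul_left]
    refine ENNReal.tsum_le_tsum fun i => ?_
    refine (pow_le_pow_left₀ zero_le (enorm_add_le _ _) 2).trans ?_
    have := ENNReal.rpow_add_le_mul_rpow_add_rpow ‖S (basis 𝕜 H i)‖ₑ ‖T (basis 𝕜 H i)‖ₑ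
      (p := 2) (by norm_num)
    norm_num at this
    exact this
  exact h.trans_lt (ENNReal.mul_lt_top (by norm_num) (ENNReal.add_lt_top.2 ⟨hS, hT⟩))

theorem IsHilbertSchmidt.neg {T : H →L[𝕜] H} (hT : IsHilbertSchmidt T) :
    IsHilbertSchmidt (-T) := by
  rwa [IsHilbertSchmidt, hsNorm_neg]

theorem IsHilbertSchmidt.sub {S T : H →L[𝕜] H} (hS : IsHilbertSchmidt S)
    (hT : IsHilbertSchmidt T) : IsHilbertSchmidt (S - T) := by
  rw [sub_eq_add_neg]
  exact hS.add hT.neg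

/-- T factors through the orthogonal projection onto M, whose squared Hilbert–Schmidt norm is, by
Parseval, a finite sum over an orthonormal basis of M. -/
theorem isHilbertSchmidt_of_eq_zero {T : H →L[𝕜] H} (M : Submodule 𝕜 H) [FiniteDimensional 𝕜 M]
    (h : ∀ x ∈ Mᗮ, T x = 0) : IsHilbertSchmidt T := by
  have hT : T = T * M.starProjection := by
    ext x
    rw [mul_apply_eq_comp, ← sub_eq_zero, ← map_sub]
    exact h _ (M.sub_starProjection_mem_orthogonal x)
  let m := stdOrthonormalBasis 𝕜 M
  have hP : ∀ x, ‖M.starProjection x‖ₑ ^ 2 = ∑ k, ‖inner 𝕜 x (m k : H)‖ₑ ^ 2 := by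
    intro x
    have h1 := m.sum_sq_norm_inner_right (M.orthogonalProjectionOnto x)
    have h2 : ∀ k, inner 𝕜 (m k) (M.orthogonalProjectionOnto x) = inner 𝕜 (m k : H) x := fun k => by
      rw [Submodule.coe_inner]
      exact M.inner_starProjection_left_eq_right _ _ |>.symm.trans (by
        rw [Submodule.starProjection_eq_self_iff.2 (m k).2])
    have h3 : ‖M.starProjection x‖ = ‖M.orthogonalProjectionOnto x‖ := rfl
    rw [← ofReal_norm, ← ENNReal.ofReal_pow (norm_nonneg _), h3, ← h1,
      ENNReal.ofReal_sum_of_nonneg fun _ _ => by positivity]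
    refine Finset.sum_congr rfl fun k _ => ?_
    rw [h2, ENNReal.ofReal_pow (norm_nonneg _), norm_inner_symm, ofReal_norm]
  have hsum : hsNormSq M.starProjection < ∞ := by
    rw [hsNormSq]
    simp_rw [hP]
    rw [Summable.tsum_finsetSum fun _ _ => ENNReal.summable, ENNReal.sum_lt_top]
    intro k _
    rw [tsum_enorm_inner_sq]
    exact ENNReal.pow_lt_top enorm_lt_top
  rw [isHilbertSchmidt_iff, hT]
  exact (hsNormSq_mul_left_le _ _).trans_lt
    (ENNReal.mul_lt_top (ENNReal.pow_lt_top enorm_lt_top) hsum)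

/-- For x orthogonal to K*eⱼ with j in a finite set s, only the coefficients j ∉ s of Kx survive, so
‖Kx‖² is at most ‖x‖² times the tail of the convergent sum of ‖K*eⱼ‖². -/
theorem IsHilbertSchmidt.exists_small {K : H →L[𝕜] H} (hK : IsHilbertSchmidt K) {ε : ℝ}
    (hε : 0 < ε) : ∃ M : Submodule 𝕜 H, FiniteDimensional 𝕜 M ∧ ∀ x ∈ Mᗮ, ‖K x‖ ≤ ε * ‖x‖ := by
  rw [isHilbertSchmidt_iff, ← hsNormSq_adjoint, hsNormSq] at hK
  have h1 := (ENNReal.tendsto_tsum_compl_atTop_zero hK.ne).eventually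
    (gt_mem_nhds (show 0 < ENNReal.ofReal ε ^ 2 by positivity))
  obtain ⟨s, hs⟩ := h1.exists
  let f : basisSet 𝕜 H → H := fun j => ContinuousLinearMap.adjoint K (basis 𝕜 H j)
  refine ⟨Submodule.span 𝕜 (f '' s), FiniteDimensional.span_of_finite 𝕜 (s.finite_toSet.image f),
    fun x hx => ?_⟩
  have h2 : ∀ j, inner 𝕜 (basis 𝕜 H j) (K x) = inner 𝕜 (f j) x := fun j => by
    rw [ContinuousLinearMap.adjoint_inner_left]
  have h3 : ∀ j ∈ s, inner 𝕜 (f j) x = 0 := fun j hj =>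
    (Submodule.mem_orthogonal _ _).1 hx _ (Submodule.subset_span ⟨j, hj, rfl⟩)
  have h4 : ‖K x‖ₑ ^ 2 ≤ (ENNReal.ofReal ε * ‖x‖ₑ) ^ 2 := by
    rw [← tsum_enorm_inner_sq (basis 𝕜 H) (K x)]
    simp_rw [h2]
    rw [← ENNReal.sum_add_tsum_compl s, Finset.sum_eq_zero fun j hj => by rw [h3 j hj]; simp,
      zero_add, mul_pow]
    calc ∑' j : ↥((s : Set (basisSet 𝕜 H))ᶜ), ‖inner 𝕜 (f j) x‖ₑ ^ 2
        ≤ ∑' j : ↥((s : Set (basisSet 𝕜 H))ᶜ), ‖f j‖ₑ ^ 2 * ‖x‖ₑ ^ 2 := by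
          refine ENNReal.tsum_le_tsum fun j => ?_
          rw [← mul_pow]
          gcongr
          rw [← ofReal_norm, ← ofReal_norm, ← ofReal_norm, ← ENNReal.ofReal_mul (norm_nonneg _)]
          exact ENNReal.ofReal_le_ofReal (norm_inner_le_norm _ _)
      _ ≤ _ := by
          rw [ENNReal.tsum_mul_right]
          gcongr
          exact hs.le
  rw [ENNReal.pow_le_pow_left_iff two_ne_zero, ← ofReal_norm, ← ofReal_norm,
    ← ENNReal.ofReal_mul hε.le, ENNReal.ofReal_le_ofReal_iff (by positivity)] at h4
  exact h4

theorem hsNormSq_eq_tsum_prod (T : H →L[𝕜] H) : hsNormSq T =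
    ∑' p : basisSet 𝕜 H × basisSet 𝕜 H, ‖inner 𝕜 (basis 𝕜 H p.2) (T (basis 𝕜 H p.1))‖ₑ ^ 2 := by
  rw [hsNormSq, ENNReal.tsum_prod']
  simp_rw [tsum_enorm_inner_sq]

/-- Finitely many matrix coefficients of an operator, as a vector of a Euclidean space. -/
noncomputable def coeffs (s : Finset (basisSet 𝕜 H × basisSet 𝕜 H)) :
    (H →L[𝕜] H) →L[𝕜] EuclideanSpace 𝕜 s :=
  (EuclideanSpace.equiv s 𝕜).symm.toContinuousLinearMap ∘L ContinuousLinearMap.pi fun p =>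
    (innerSL 𝕜 (basis 𝕜 H p.1.2)) ∘L (ContinuousLinearMap.apply 𝕜 H (basis 𝕜 H p.1.1))

theorem coeffs_apply (s : Finset (basisSet 𝕜 H × basisSet 𝕜 H)) (T : H →L[𝕜] H) (p : s) :
    coeffs s T p = inner 𝕜 (basis 𝕜 H p.1.2) (T (basis 𝕜 H p.1.1)) := rfl

theorem enorm_coeffs_sq (s : Finset (basisSet 𝕜 H × basisSet 𝕜 H)) (T : H →L[𝕜] H) :
    ‖coeffs s T‖ₑ ^ 2 = ∑ p ∈ s, ‖inner 𝕜 (basis 𝕜 H p.2) (T (basis 𝕜 H p.1))‖ₑ ^ 2 := by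
  rw [← ofReal_norm, ← ENNReal.ofReal_pow (norm_nonneg _), EuclideanSpace.norm_sq_eq,
    ENNReal.ofReal_sum_of_nonneg fun _ _ => by positivity, ← Finset.sum_coe_sort s]
  refine Finset.sum_congr rfl fun p _ => ?_
  rw [coeffs_apply, ENNReal.ofReal_pow (norm_nonneg _), ofReal_norm]

theorem enorm_coeffs_le (s : Finset (basisSet 𝕜 H × basisSet 𝕜 H)) (T : H →L[𝕜] H) :
    ‖coeffs s T‖ₑ ≤ hsNorm T := by
  rw [← ENNReal.pow_le_pow_left_iff two_ne_zero, hsNorm_sq, enorm_coeffs_sq,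
    hsNormSq_eq_tsum_prod]
  exact ENNReal.sum_le_tsum s

/-- The Hilbert–Schmidt norm is a supremum over finite blocks of matrix coefficients. Integrals and
weak limits can therefore be estimated in finite-dimensional Euclidean spaces, where weak and norm
convergence coincide. -/
theorem hsNorm_le_of_coeffs {T : H →L[𝕜] H} {C : ℝ≥0∞} (h : ∀ s, ‖coeffs s T‖ₑ ≤ C) :
    hsNorm T ≤ C := by
  rw [hsNorm_le_iff, hsNormSq_eq_tsum_prod, ENNReal.tsum_eq_iSup_sum]
  refine iSup_le fun s => ?_
  rw [← enorm_coeffs_sq]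
  gcongr
  exact h s

end HilbertSchmidtLemmas

/-! ### The sharp estimate when both operators are invertible -/

section Main

open MeasureTheory Filter Topology

variable {H : Type*} [NormedAddCommGroup H] [InnerProductSpace ℂ H] [CompleteSpace H]
variable {A B : H →ₗ.[ℂ] H} {K : H →L[ℂ] H}

/-- The second resolvent identity: apply S to (A + K − z)Rx = x + KRx. -/
theorem IsResolventAt.perturb_sub {H : Type*} [NormedAddCommGroup H] [InnerProductSpace ℂ H]
    {A : H →ₗ.[ℂ] H} {K : H →L[ℂ] H} {z : ℂ} {R S : H →L[ℂ] H} (hR : IsResolventAt A z R)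
    (hS : IsResolventAt (perturb A K) z S) : S - R = -(S * K * R) := by
  ext x
  obtain ⟨h, hx⟩ := hR.1 x
  have h1 : S (K (R x) + A ⟨R x, h⟩ - z • R x) = R x := hS.2 ⟨R x, h⟩
  rw [add_sub_assoc, hx, map_add] at h1
  simp only [sub_apply, neg_apply, mul_apply_eq_comp]
  rw [eq_sub_of_add_eq' h1]
  abel

theorem IsSA.isBelow_mul_I {H : Type*} [NormedAddCommGroup H] [InnerProductSpace ℂ H]
    {A : H →ₗ.[ℂ] H} (hA : IsSA A) {a : ℝ} (ha : 0 ≤ a) (h : IsBelow A 0 a) {z : ℂ}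
    (hz : z.re = 0) : IsBelow A z (Real.sqrt (a ^ 2 + z.im ^ 2)) := by
  intro x
  have h1 := h x
  rw [zero_smul, sub_zero] at h1
  rw [← sq_le_sq₀ (by positivity) (norm_nonneg _), hA.norm_sub_smul_sq, mul_pow,
    Real.sq_sqrt (by positivity), hz, Complex.ofReal_zero, zero_smul, sub_zero, add_mul, ← mul_pow]
  gcongr

theorem IsSA.enorm_coeffs_res_sub_le (hA : IsSA A) (hB : IsSA (perturb A K))
    (hK : IsHilbertSchmidt K) {a : ℝ} (ha : 0 < a) (h1 : IsBelow A 0 a)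
    (h2 : IsBelow (perturb A K) 0 a) {z : ℂ} (hz : z.re = 0) (hz' : z.im ≠ 0)
    (s : Finset (basisSet ℂ H × basisSet ℂ H)) :
    ‖coeffs s (res (perturb A K) z - res A z)‖ ≤ (hsNorm K).toReal / (a ^ 2 + z.im ^ 2) := by
  have hR := hA.isResolventAt_res hz'
  have hS := hB.isResolventAt_res hz'
  have hpos : 0 < a ^ 2 + z.im ^ 2 := by positivity
  have hsq := Real.sqrt_pos.2 hpos
  have hRn := hR.norm_le hsq (hA.isBelow_mul_I ha.le h1 hz)
  have hSn := hS.norm_le hsq (hB.isBelow_mul_I ha.le h2 hz)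
  have h3 := (enorm_coeffs_le s (res (perturb A K) z - res A z)).trans_eq
    (congrArg hsNorm (hR.perturb_sub hS))
  rw [hsNorm_neg] at h3
  have h4 := h3.trans (hsNorm_mul_mul_le _ _ _)
  have h5 : ‖coeffs s (res (perturb A K) z - res A z)‖ ≤
      ‖res (perturb A K) z‖ * ‖res A z‖ * (hsNorm K).toReal := by
    have h6 := ENNReal.toReal_mono (by finiteness [hK.ne]) h4
    simpa using h6
  refine h5.trans ?_
  rw [div_eq_mul_inv, mul_comm]
  gcongr
  refine (mul_le_mul hSn hRn (norm_nonneg _) (by positivity)).trans_eq ?_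
  rw [← mul_inv, Real.mul_self_sqrt hpos.le]

/-- Complex polarization recovers the whole sesquilinear form from its quadratic form. -/
theorem tendsto_inner_of_tendsto_inner_self {H : Type*} [NormedAddCommGroup H]
    [InnerProductSpace ℂ H] {T : ℕ → H →L[ℂ] H} {S : H →L[ℂ] H}
    (h : ∀ x, Tendsto (fun n => inner ℂ x (T n x)) atTop (𝓝 (inner ℂ x (S x)))) (x y : H) :
    Tendsto (fun n => inner ℂ y (T n x)) atTop (𝓝 (inner ℂ y (S x))) := by
  have h1 : ∀ x, Tendsto (fun n => inner ℂ (T n x) x) atTop (𝓝 (inner ℂ (S x) x)) := fun x => by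
    have := (Complex.continuous_conj.tendsto _).comp (h x)
    simpa only [Function.comp_def, inner_conj_symm] using this
  have h2 : Tendsto (fun n => inner ℂ (T n x) y) atTop (𝓝 (inner ℂ (S x) y)) := by
    have e : ∀ U : H →L[ℂ] H, inner ℂ (U x) y = _ := fun U =>
      inner_map_polarization' (U : H →ₗ[ℂ] H) x y
    simp only [e]
    exact ((((h1 _).sub (h1 _)).sub ((h1 _).const_mul _)).add ((h1 _).const_mul _)).div_const _
  have := (Complex.continuous_conj.tendsto _).comp h2
  simpa only [Function.comp_def, inner_conj_symm] using this

/-- The sharp estimate for a pair of invertible self-adjoint operators. -/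
theorem IsSA.hsNorm_sign_sub_le (hA : IsSA A) (hB : IsSA (perturb A K))
    (hK : IsHilbertSchmidt K) {a : ℝ} (ha : 0 < a) (h1 : IsBelow A 0 a)
    (h2 : IsBelow (perturb A K) 0 a) {S T : H →L[ℂ] H} (hS : IsFunctionOf A Real.sign S)
    (hT : IsFunctionOf (perturb A K) Real.sign T) :
    hsNorm (T - S) ≤ hsNorm K / ENNReal.ofReal a := by
  refine hsNorm_le_of_coeffs fun s => ?_
  have key : ‖coeffs s (T - S)‖ ≤ (hsNorm K).toReal / a := by
    have hlim : Tendsto (fun n => coeffs s (truncSign (perturb A K) n - truncSign A n)) atTop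
        (𝓝 (coeffs s (T - S))) := by
      have h3 : ∀ x, Tendsto (fun n => inner ℂ x ((truncSign (perturb A K) n - truncSign A n) x))
          atTop (𝓝 (inner ℂ x ((T - S) x))) := by
        intro x
        simp only [sub_apply, inner_sub_right]
        obtain ⟨μ, hμ, hx⟩ := hT x
        obtain ⟨μ', hμ', hx'⟩ := hS x
        rw [hx, hx']
        exact (hB.tendsto_inner_truncSign hμ).sub (hA.tendsto_inner_truncSign hμ')
      have h4 : Tendsto (fun n => (EuclideanSpace.equiv s ℂ)
          (coeffs s (truncSign (perturb A K) n - truncSign A n))) atTop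
          (𝓝 ((EuclideanSpace.equiv s ℂ) (coeffs s (T - S)))) :=
        tendsto_pi_nhds.2 fun p => tendsto_inner_of_tendsto_inner_self h3 _ _
      have h5 := ((EuclideanSpace.equiv s ℂ).symm.continuous.tendsto _).comp h4
      simpa only [Function.comp_def, ContinuousLinearEquiv.symm_apply_apply] using h5
    refine le_of_tendsto hlim.norm (Eventually.of_forall fun n => ?_)
    have hb : 0 < (n : ℝ) + 1 := by positivity
    have hb' := inv_pos.2 hb
    have hle : ((n : ℝ) + 1)⁻¹ ≤ (n : ℝ) + 1 := by
      refine (inv_le_one_of_one_le₀ ?_).trans ?_ <;> linarith [n.cast_nonneg (α := ℝ)]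
    have hiA := hA.intervalIntegrable_resSum hb' hb
    have hiB := hB.intervalIntegrable_resSum hb' hb
    have h5 : coeffs s (truncSign (perturb A K) n - truncSign A n) = (Real.pi : ℂ)⁻¹ •
        ∫ r in ((n : ℝ) + 1)⁻¹..((n : ℝ) + 1),
          coeffs s (resSum (perturb A K) r - resSum A r) := by
      rw [truncSign, truncSign, ← smul_sub, map_smul, ← intervalIntegral.integral_sub hiB hiA,
        (coeffs s).intervalIntegral_comp_comm (hiB.sub hiA)]
    -- The points ir and −ir contribute ‖K‖/(a²+r²) each. Their sum is written as (‖K‖/a) times the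
    -- kernel 2a/(a²+r²), so that `integral_kernel` applies with t = a.
    have h6 : ‖∫ r in ((n : ℝ) + 1)⁻¹..((n : ℝ) + 1),
        coeffs s (resSum (perturb A K) r - resSum A r)‖ ≤
        ∫ r in ((n : ℝ) + 1)⁻¹..((n : ℝ) + 1),
          ((hsNorm K).toReal / a) * (2 * a / (a ^ 2 + r ^ 2)) := by
      refine intervalIntegral.norm_integral_le_of_norm_le hle
        (Eventually.of_forall fun r hr => ?_) ?_
      · have hr0 : r ≠ 0 := (hb'.trans hr.1).ne'
        have e : resSum (perturb A K) r - resSum A r =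
            (res (perturb A K) (r * Complex.I) - res A (r * Complex.I)) +
            (res (perturb A K) (-r * Complex.I) - res A (-r * Complex.I)) := by
          rw [resSum, resSum]
          abel
        have e1 := hA.enorm_coeffs_res_sub_le hB hK ha h1 h2 (z := r * Complex.I) (by simp)
          (by simpa using hr0) s
        have e2 := hA.enorm_coeffs_res_sub_le hB hK ha h1 h2 (z := -r * Complex.I) (by simp)
          (by simpa using hr0) s
        have i1 : ((r : ℂ) * Complex.I).im = r := by simp
        have i2 : (-(r : ℂ) * Complex.I).im = -r := by simp
        rw [i1] at e1
        rw [i2, neg_sq] at e2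
        rw [e, map_add]
        refine (norm_add_le _ _).trans ((add_le_add e1 e2).trans_eq ?_)
        have : a ^ 2 + r ^ 2 ≠ 0 := by positivity
        field_simp
        ring
      · refine ContinuousOn.intervalIntegrable (ContinuousOn.mul (by fun_prop)
          (ContinuousOn.div (by fun_prop) (by fun_prop) fun r _ => ?_))
        positivity
    rw [intervalIntegral.integral_const_mul, integral_kernel hb' hb] at h6
    -- The kernel integrates to at most π, which cancels the factor 1/π and leaves the constant 1/a.
    have h7 : 2 * (Real.arctan (((n : ℝ) + 1) / a) - Real.arctan (((n : ℝ) + 1)⁻¹ / a)) ≤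
        Real.pi := by
      have := Real.arctan_lt_pi_div_two (((n : ℝ) + 1) / a)
      have := Real.arctan_nonneg.2 (show 0 ≤ ((n : ℝ) + 1)⁻¹ / a by positivity)
      linarith
    rw [h5, norm_smul, norm_inv, Complex.norm_real, Real.norm_of_nonneg Real.pi_pos.le,
      inv_mul_le_iff₀ Real.pi_pos, mul_comm]
    exact h6.trans (by gcongr)
  calc ‖coeffs s (T - S)‖ₑ = ENNReal.ofReal ‖coeffs s (T - S)‖ := (ofReal_norm _).symm
    _ ≤ ENNReal.ofReal ((hsNorm K).toReal / a) := ENNReal.ofReal_le_ofReal key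
    _ = _ := by rw [ENNReal.ofReal_div_of_pos ha, ENNReal.ofReal_toReal hK.ne]

end Main

end SkewFredholm

namespace SkewFredholm

/-! ### Lower bounds, spectrum, and discreteness near 0 -/

section Gap

open MeasureTheory Filter Topology

variable {H : Type*} [NormedAddCommGroup H] [InnerProductSpace ℂ H]
variable {A : H →ₗ.[ℂ] H} {N K : H →L[ℂ] H}

theorem IsBelow.add {z u : ℂ} {c : ℝ} (h : IsBelow A z c) : IsBelow A (z + u) (c - ‖u‖) := by
  intro x
  have h1 := h x
  have h2 : A x - z • (x : H) = (A x - (z + u) • (x : H)) + u • (x : H) := by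
    rw [add_smul]
    abel
  have h3 := norm_add_le (A x - (z + u) • (x : H)) (u • (x : H))
  rw [← h2, norm_smul] at h3
  linarith

variable [CompleteSpace H]

theorem IsSA.perturb (hA : IsSA A) (hK : ContinuousLinearMap.adjoint K = K) :
    IsSA (perturb A K) := by
  have hq : ∀ x y : H, inner ℂ (K x) y = inner ℂ x (K y) := fun x y => by
    rw [← ContinuousLinearMap.adjoint_inner_right, hK]
  refine ⟨hA.dense, fun x y => ?_, fun x z h => ?_⟩
  · rw [perturb_apply, perturb_apply, inner_add_left, inner_add_right, hq, hA.symm x y]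
  · obtain ⟨h1, h2⟩ := hA.maximal x (z - K x) fun y => by
      have : inner ℂ x (K y + A y) = inner ℂ z (y : H) := h y
      rw [inner_add_right] at this
      rw [inner_sub_left, hq, eq_sub_of_add_eq' this]
    refine ⟨h1, ?_⟩
    have h3 : SkewFredholm.perturb A K ⟨x, h1⟩ = K x + A ⟨x, h1⟩ := rfl
    rw [h3, h2]
    abel

theorem IsSA.apply_sub_eq_cfc (hA : IsSA A) (hN : IsResolventAt A Complex.I N) (z : ℂ)
    (x : A.domain) : ∃ y, (x : H) = N y ∧
      A x - z • (x : H) = cfc (fun w => 1 + (Complex.I - z) * w) N y := by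
  have hn := hA.isStarNormal hN
  refine ⟨A x - Complex.I • (x : H), (hN.2 x).symm, ?_⟩
  rw [cfc_const_add (1 : ℂ) (fun w => (Complex.I - z) * w) N,
    cfc_const_mul_id (Complex.I - z) N, map_one, add_apply, smul_apply, hN.2 x, one_apply_eq_self,
    sub_smul]
  abel

/-- Writing x = N y turns r·x and (A−z)x into operators with symbols r·w and 1+(i−z)w applied to the
same y. -/
theorem IsSA.isBelow_of_spectrum (hA : IsSA A) (hN : IsResolventAt A Complex.I N) {z : ℂ} {r : ℝ}
    (hr : 0 ≤ r) (h : ∀ w ∈ spectrum ℂ N, r * ‖w‖ ≤ ‖1 + (Complex.I - z) * w‖) :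
    IsBelow A z r := by
  have hn := hA.isStarNormal hN
  intro x
  obtain ⟨y, hy, hz⟩ := hA.apply_sub_eq_cfc hN z x
  have h1 : r * ‖(x : H)‖ = ‖cfc (fun w => (r : ℂ) * w) N y‖ := by
    rw [cfc_const_mul_id (r : ℂ) N, smul_apply, norm_smul, ← hy, Complex.norm_real,
      Real.norm_of_nonneg hr]
  rw [h1, hz]
  refine norm_cfc_apply_le hn (by fun_prop) (by fun_prop) (fun w hw => ?_) y
  rw [norm_mul, Complex.norm_real, Real.norm_of_nonneg hr]
  exact h w hw

/-- The operator (A−z)N = 1 + (i−z)N is invertible with inverse (A−i)R = 1 − (i−z)R, so its symbol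
has no zero on the spectrum of N. -/
theorem IsSA.one_add_ne_zero_of_resolvent (hA : IsSA A) (hN : IsResolventAt A Complex.I N) {z : ℂ}
    {R : H →L[ℂ] H} (hR : IsResolventAt A z R) {w : ℂ} (hw : w ∈ spectrum ℂ N) :
    1 + (Complex.I - z) * w ≠ 0 := by
  have hn := hA.isStarNormal hN
  have h1 := hN.sub_eq hR
  have h2 := resolvent_mul_comm hN hR
  have h3 : cfc (fun w => 1 + (Complex.I - z) * w) N = 1 + (Complex.I - z) • N := by
    rw [cfc_const_add (1 : ℂ) (fun w => (Complex.I - z) * w) N,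
      cfc_const_mul_id (Complex.I - z) N, map_one]
  have h4 : (1 + (Complex.I - z) • N) * (1 - (Complex.I - z) • R) = 1 := by
    have : (Complex.I - z) • (N - R - (Complex.I - z) • (N * R)) = 0 := by
      rw [h1, sub_self, smul_zero]
    simp only [mul_sub, add_mul, mul_one, one_mul, smul_mul_smul_comm]
    rw [smul_sub, smul_sub, smul_smul] at this
    rw [← sub_eq_zero, ← this]
    module
  have h5 : (1 - (Complex.I - z) • R) * (1 + (Complex.I - z) • N) = 1 := by
    have : (Complex.I - z) • (N - R - (Complex.I - z) • (R * N)) = 0 := by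
      rw [← h2, h1, sub_self, smul_zero]
    simp only [mul_add, sub_mul, mul_one, one_mul, smul_mul_smul_comm]
    rw [smul_sub, smul_sub, smul_smul] at this
    rw [← sub_eq_zero, ← this]
    module
  have h6 : IsUnit (cfc (fun w => 1 + (Complex.I - z) * w) N) := by
    rw [h3]
    exact ⟨⟨_, _, h4, h5⟩, rfl⟩
  exact (isUnit_cfc_iff (fun w => 1 + (Complex.I - z) * w) N (by fun_prop) hn).1 h6 w hw

/-- A self-adjoint operator is bounded below by the distance from `0` to its spectrum. -/
theorem IsSA.isBelow_of_resolvent (hA : IsSA A) {a : ℝ} (ha : 0 ≤ a)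
    (h : ∀ l : ℝ, |l| < a → ∃ R, IsResolventAt A (l : ℂ) R) : IsBelow A 0 a := by
  obtain ⟨N, hN⟩ := hA.exists_resolvent_of_im_ne (z := Complex.I) (by simp)
  refine hA.isBelow_of_spectrum hN ha fun w hw => ?_
  rcases eq_or_ne w 0 with rfl | h0
  · simp
  · rw [hA.one_add_eq hN hw h0, norm_mul, mul_comm, sub_zero, Complex.norm_real, Real.norm_eq_abs]
    gcongr
    -- A spectral point with |t| < a would have t = `coord w` in the resolvent set of A, while the
    -- symbol w(t − l) vanishes at l = t.
    by_contra hlt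
    obtain ⟨R, hR⟩ := h (coord w) (not_le.1 hlt)
    apply hA.one_add_ne_zero_of_resolvent hN hR hw
    rw [hA.one_add_eq hN hw h0, sub_self, mul_zero]

/-- A bump function, in the coordinate `w = (t - i)⁻¹`, supported in `|t - l| ≤ r`. -/
noncomputable def bump (l r : ℝ) (w : ℂ) : ℂ :=
  ((max 0 (r * ‖w‖ - ‖1 + (Complex.I - l) * w‖) : ℝ) : ℂ)

theorem continuous_bump (l r : ℝ) : Continuous (bump l r) := by
  unfold bump
  fun_prop

theorem bump_ne_zero_iff {l r : ℝ} {w : ℂ} :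
    bump l r w ≠ 0 ↔ ‖1 + (Complex.I - l) * w‖ < r * ‖w‖ := by
  rw [bump, Ne, Complex.ofReal_eq_zero, max_eq_left_iff, not_le, sub_pos]

/-- The operator with symbol `w * bump l r w`. -/
noncomputable def bumpOp (N : H →L[ℂ] H) (l r : ℝ) : H →L[ℂ] H :=
  cfc (fun w => w * bump l r w) N

/-- The symbol of `bumpOp` lives where |t − l| < r, so A − l acts on its range with norm at most r.
-/
theorem IsSA.bumpOp_mem (hA : IsSA A) (hN : IsResolventAt A Complex.I N) {l r : ℝ} (hr : 0 ≤ r)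
    (x : H) : ∃ h : bumpOp N l r x ∈ A.domain,
      ‖A ⟨_, h⟩ - (l : ℂ) • bumpOp N l r x‖ ≤ r * ‖bumpOp N l r x‖ := by
  have hn := hA.isStarNormal hN
  have hc := continuous_bump l r
  obtain ⟨h, h1⟩ := hA.apply_resolvent_cfc hN hc.continuousOn (l : ℂ) x
  refine ⟨h, ?_⟩
  have h2 : r * ‖bumpOp N l r x‖ = ‖cfc (fun w => (r : ℂ) * (w * bump l r w)) N x‖ := by
    rw [cfc_const_mul (r : ℂ) (fun w => w * bump l r w) N, smul_apply, norm_smul,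
      Complex.norm_real, Real.norm_of_nonneg hr]
    rfl
  rw [h2]
  refine (congrArg norm h1).trans_le ?_
  refine norm_cfc_apply_le hn (by fun_prop) (by fun_prop) (fun w hw => ?_) x
  rw [← mul_assoc, norm_mul, norm_mul, norm_mul, Complex.norm_real, Real.norm_of_nonneg hr]
  by_cases hb : bump l r w = 0
  · simp [hb]
  · gcongr
    exact (bump_ne_zero_iff.1 hb).le

/-- The projection onto M is injective on this range: a vector v of it orthogonal to M satisfies
c‖v‖ ≤ ‖Av‖ ≤ r‖v‖ with r < c, hence is 0. -/
theorem IsSA.finiteDimensional_range_bumpOp (hA : IsSA A) (hN : IsResolventAt A Complex.I N)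
    {M : Submodule ℂ H} [FiniteDimensional ℂ M] {c : ℝ}
    (hM : ∀ x : A.domain, (x : H) ∈ Mᗮ → c * ‖(x : H)‖ ≤ ‖A x‖) {r : ℝ} (hr : 0 ≤ r)
    (hrc : r < c) : FiniteDimensional ℂ (LinearMap.range (bumpOp N 0 r).toLinearMap) := by
  let P : LinearMap.range (bumpOp N 0 r).toLinearMap →ₗ[ℂ] M :=
    M.orthogonalProjectionOnto.toLinearMap ∘ₗ Submodule.subtype _
  refine FiniteDimensional.of_injective P ?_
  rw [injective_iff_map_eq_zero]
  rintro ⟨v, x, rfl⟩ hv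
  have h1 : bumpOp N 0 r x ∈ Mᗮ := by
    have h2 : M.orthogonalProjectionOnto (bumpOp N 0 r x) = 0 := hv
    rwa [Submodule.orthogonalProjectionOnto_eq_zero_iff] at h2
  obtain ⟨h3, h4⟩ := hA.bumpOp_mem hN (l := 0) hr x
  have h5 := hM ⟨_, h3⟩ h1
  rw [Complex.ofReal_zero, zero_smul, sub_zero] at h4
  have h6 : ‖bumpOp N 0 r x‖ = 0 := by
    have h7 := norm_nonneg (bumpOp N 0 r x)
    have h8 : c * ‖bumpOp N 0 r x‖ ≤ r * ‖bumpOp N 0 r x‖ := h5.trans h4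
    nlinarith
  exact Subtype.ext (norm_eq_zero.1 h6)

theorem IsSA.isBelow_of_bumpOp_eq_zero (hA : IsSA A) (hN : IsResolventAt A Complex.I N) {l r : ℝ}
    (hr : 0 ≤ r) (h : bumpOp N l r = 0) : IsBelow A l r := by
  have hn := hA.isStarNormal hN
  have hc := continuous_bump l r
  refine hA.isBelow_of_spectrum hN hr fun w hw => ?_
  have h1 : cfc (fun w => w * bump l r w) N = cfc (fun _ => (0 : ℂ)) N := by
    rw [cfc_const_zero]
    exact h
  have h2 := eqOn_of_cfc_eq_cfc h1 (by fun_prop) (by fun_prop) hn hw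
  by_contra hlt
  rcases mul_eq_zero.1 h2 with h0 | h0
  · rw [h0] at hlt
    simp at hlt
  · exact bump_ne_zero_iff.2 (not_le.1 hlt) h0

/-- Only finitely many members of a disjoint family of intervals close to `0` meet the spectrum. -/
theorem IsSA.finite_not_isBelow (hA : IsSA A) {M : Submodule ℂ H} [FiniteDimensional ℂ M] {c : ℝ}
    (hc : 0 < c) (hM : ∀ x : A.domain, (x : H) ∈ Mᗮ → c * ‖(x : H)‖ ≤ ‖A x‖) {l r : ℕ → ℝ}
    (hr : ∀ k, 0 ≤ r k) (hlr : ∀ k, |l k| + r k ≤ c / 2)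
    (hdisj : ∀ j k, j ≠ k → r j + r k ≤ |l j - l k|) : {k | ¬ IsBelow A (l k) (r k)}.Finite := by
  obtain ⟨N, hN⟩ := hA.exists_resolvent_of_im_ne (z := Complex.I) (by simp)
  have hn := hA.isStarNormal hN
  have hbc : ∀ l r, Continuous (bump l r) := continuous_bump
  have hfd := hA.finiteDimensional_range_bumpOp hN hM (half_pos hc).le (half_lt_self hc)
  have hmul : ∀ k, bumpOp N 0 (c / 2) * bumpOp N (l k) (r k) =
      cfc (fun w => (w * bump 0 (c / 2) w) * (w * bump (l k) (r k) w)) N := fun k => by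
    rw [cfc_mul (fun w => w * bump 0 (c / 2) w) (fun w => w * bump (l k) (r k) w) N
      (by have := hbc 0 (c / 2); fun_prop) (by have := hbc (l k) (r k); fun_prop)]
    rfl
  have hcont : ∀ k, Continuous
      fun w => (w * bump 0 (c / 2) w) * (w * bump (l k) (r k) w) := fun k => by
    have := hbc 0 (c / 2)
    have := hbc (l k) (r k)
    fun_prop
  -- The interval around `l k` lies inside |t| ≤ c/2, so composing with the bump at 0 loses nothing,
  -- while all values now lie in one finite-dimensional space.
  have hne : ∀ k : {k | ¬ IsBelow A (l k) (r k)},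
      ∃ x, bumpOp N 0 (c / 2) (bumpOp N (l k) (r k) x) ≠ 0 := by
    rintro ⟨k, hk⟩
    by_contra! hzero
    refine hk (hA.isBelow_of_bumpOp_eq_zero hN (hr k) ?_)
    have h1 : bumpOp N 0 (c / 2) * bumpOp N (l k) (r k) = cfc (fun _ => (0 : ℂ)) N := by
      rw [cfc_const_zero]
      ext x
      exact hzero x
    rw [hmul] at h1
    rw [bumpOp, ← cfc_const_zero ℂ N]
    refine cfc_congr fun w hw => ?_
    have h2 := eqOn_of_cfc_eq_cfc h1 (hcont k).continuousOn (by fun_prop) hn hw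
    by_contra hw'
    refine mul_ne_zero (mul_ne_zero (left_ne_zero_of_mul hw') ?_) hw' h2
    have h3 := bump_ne_zero_iff.1 (right_ne_zero_of_mul hw')
    rw [bump_ne_zero_iff]
    have h4 : 1 + (Complex.I - (0 : ℝ)) * w = (1 + (Complex.I - l k) * w) + l k * w := by
      push_cast
      ring
    rw [h4]
    refine (norm_add_le _ _).trans_lt ?_
    rw [norm_mul, Complex.norm_real, Real.norm_eq_abs]
    nlinarith [hlr k, norm_nonneg w]
  choose x hx using hne
  let v : {k | ¬ IsBelow A (l k) (r k)} → LinearMap.range (bumpOp N 0 (c / 2)).toLinearMap :=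
    fun k => ⟨bumpOp N 0 (c / 2) (bumpOp N (l k) (r k) (x k)), _, rfl⟩
  -- Bumps at distinct indices have disjoint supports, so the chosen nonzero vectors are mutually
  -- orthogonal; a finite-dimensional space holds only finitely many.
  have hli : LinearIndependent ℂ v := by
    refine linearIndependent_of_ne_zero_of_inner_eq_zero
      (fun k h => hx k (congrArg Subtype.val h)) fun j k hjk => ?_
    change inner ℂ ((bumpOp N 0 (c / 2) * bumpOp N (l j) (r j)) (x j))
      ((bumpOp N 0 (c / 2) * bumpOp N (l k) (r k)) (x k)) = 0
    rw [hmul, hmul, ← ContinuousLinearMap.adjoint_inner_right, ← ContinuousLinearMap.star_eq_adjoint,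
      ← cfc_star, ← mul_apply_eq_comp, ← cfc_mul _ _ N (hcont j).star.continuousOn
      (hcont k).continuousOn]
    have h0 : cfc (fun w => star ((w * bump 0 (c / 2) w) * (w * bump (l j) (r j) w)) *
        ((w * bump 0 (c / 2) w) * (w * bump (l k) (r k) w))) N = cfc (fun _ => (0 : ℂ)) N := by
      refine cfc_congr fun w hw => ?_
      by_contra hw'
      have h1 := bump_ne_zero_iff.1 (right_ne_zero_of_mul (right_ne_zero_of_mul
        (star_ne_zero.1 (left_ne_zero_of_mul hw'))))
      have h2 := bump_ne_zero_iff.1 (right_ne_zero_of_mul (right_ne_zero_of_mul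
        (right_ne_zero_of_mul hw')))
      have h3 : ((l (j : ℕ) - l (k : ℕ) : ℝ) : ℂ) * w = (1 + (Complex.I - l k) * w) -
          (1 + (Complex.I - l j) * w) := by
        push_cast
        ring
      have h4 := norm_sub_le (1 + (Complex.I - l k) * w) (1 + (Complex.I - l j) * w)
      rw [← h3, norm_mul, Complex.norm_real, Real.norm_eq_abs] at h4
      have h5 := hdisj j k (fun h => hjk (Subtype.ext h))
      nlinarith [norm_nonneg w]
    rw [h0, cfc_const_zero]
    simp
  exact Set.finite_coe_iff.1 hli.finite

end Gap

end SkewFredholm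

namespace SkewFredholm

/-! ### Moving the jump of the sign into a common spectral gap -/

section Shift

open MeasureTheory Filter Topology

variable {H : Type*} [NormedAddCommGroup H] [InnerProductSpace ℂ H]

/-- The operator `A - l` for a real number `l`. -/
noncomputable def shift (A : H →ₗ.[ℂ] H) (l : ℝ) : H →ₗ.[ℂ] H := perturb A (-(l : ℂ) • 1)

theorem perturb_perturb (A : H →ₗ.[ℂ] H) (K L : H →L[ℂ] H) :
    perturb (perturb A K) L = perturb (perturb A L) K := by
  rw [perturb, perturb, perturb, perturb, vadd_vadd, vadd_vadd, add_comm]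

theorem shift_apply (A : H →ₗ.[ℂ] H) (l : ℝ) (x : A.domain) :
    shift A l x = A x - (l : ℂ) • (x : H) := by
  have : shift A l x = (-(l : ℂ)) • (x : H) + A x := rfl
  rw [this, neg_smul]
  abel

theorem isResolventAt_shift {A : H →ₗ.[ℂ] H} {l : ℝ} {z : ℂ} {R : H →L[ℂ] H} :
    IsResolventAt (shift A l) z R ↔ IsResolventAt A (z + l) R := by
  have e : ∀ x : A.domain, shift A l x - z • (x : H) = A x - (z + l) • (x : H) := fun x => by
    rw [shift_apply, add_smul]
    abel
  constructor
  · rintro ⟨h1, h2⟩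
    refine ⟨fun x => ?_, fun y => ?_⟩
    · obtain ⟨h, hx⟩ := h1 x
      exact ⟨h, (e ⟨R x, h⟩).symm.trans hx⟩
    · rw [← e]
      exact h2 y
  · rintro ⟨h1, h2⟩
    refine ⟨fun x => ?_, fun y => ?_⟩
    · obtain ⟨h, hx⟩ := h1 x
      exact ⟨h, (e ⟨R x, h⟩).trans hx⟩
    · exact (congrArg R (e y)).trans (h2 y)

theorem IsBelow.shift {A : H →ₗ.[ℂ] H} {l c : ℝ} (h : IsBelow A l c) :
    IsBelow (shift A l) 0 c := by
  intro x
  rw [zero_smul, sub_zero]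
  exact (h x).trans_eq (congrArg norm (shift_apply A l x).symm)

theorem IsSpectralMeasureAt.shift {A : H →ₗ.[ℂ] H} {x : H} {μ : Measure ℝ}
    (h : IsSpectralMeasureAt A x μ) (l : ℝ) :
    IsSpectralMeasureAt (shift A l) x (μ.map fun t => t - l) := by
  have := h.1
  refine ⟨Measure.isFiniteMeasure_map _ _, fun z hz => ?_⟩
  obtain ⟨R, hR, hx⟩ := h.2 (z + l) (by simpa using hz)
  have hm : Measurable fun t : ℝ => ((t : ℂ) - z)⁻¹ :=
    (Complex.measurable_ofReal.sub_const z).inv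
  refine ⟨R, isResolventAt_shift.2 hR, hx.trans ?_⟩
  rw [integral_map (by fun_prop) hm.aestronglyMeasurable]
  refine integral_congr_ae (Eventually.of_forall fun t => ?_)
  dsimp only
  congr 1
  push_cast
  ring

variable [CompleteSpace H]

theorem IsSA.shift {A : H →ₗ.[ℂ] H} (hA : IsSA A) (l : ℝ) : IsSA (shift A l) := by
  refine hA.perturb ?_
  rw [← ContinuousLinearMap.star_eq_adjoint, star_smul, star_one]
  simp

theorem eq_zero_of_nonneg_of_inner {W : H →L[ℂ] H} (hW : 0 ≤ W) {x : H}
    (hx : inner ℂ x (W x) = 0) : W x = 0 := by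
  obtain ⟨V, rfl⟩ := CStarAlgebra.nonneg_iff_eq_star_mul_self.1 hW
  rw [mul_apply_eq_comp, ContinuousLinearMap.star_eq_adjoint,
    ContinuousLinearMap.adjoint_inner_right, inner_self_eq_zero] at hx
  rw [mul_apply_eq_comp, hx, map_zero]

theorem sign_sub_nonneg {t l : ℝ} (hl : 0 ≤ l) : 0 ≤ Real.sign t - Real.sign (t - l) := by
  rcases lt_trichotomy t 0 with h | h | h
  · rw [Real.sign_of_neg h, Real.sign_of_neg (by linarith)]; simp
  · rcases Real.sign_apply_eq (t - l) with h' | h' | h'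
    · rw [h, Real.sign_zero, ← h, h']; norm_num
    · rw [h, Real.sign_zero, ← h, h']; norm_num
    · have : t - l ≤ 0 := by linarith
      rcases this.lt_or_eq with h2 | h2
      · rw [Real.sign_of_neg h2] at h'; norm_num at h'
      · rw [h2, Real.sign_zero] at h'; norm_num at h'
  · rw [Real.sign_of_pos h]
    rcases Real.sign_apply_eq (t - l) with h' | h' | h' <;> rw [h'] <;> norm_num

theorem sign_sub_eq {t l : ℝ} (h : |l| < |t|) : Real.sign (t - l) = Real.sign t := by
  rcases lt_trichotomy t 0 with h1 | h1 | h1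
  · rw [abs_of_neg h1] at h
    rw [Real.sign_of_neg h1, Real.sign_of_neg (by linarith [neg_abs_le l])]
  · rw [h1, abs_zero] at h
    exact absurd h (not_lt.2 (abs_nonneg l))
  · rw [abs_of_pos h1] at h
    rw [Real.sign_of_pos h1, Real.sign_of_pos (by linarith [le_abs_self l])]

/-- Moving the jump of the sign inside a gap of the essential spectrum is a perturbation of finite
rank. -/
theorem IsSA.isHilbertSchmidt_sign_sub_shift {A : H →ₗ.[ℂ] H} (hA : IsSA A)
    {M : Submodule ℂ H} [FiniteDimensional ℂ M] {c : ℝ}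
    (hM : ∀ x : A.domain, (x : H) ∈ Mᗮ → c * ‖(x : H)‖ ≤ ‖A x‖) {l : ℝ} (hl : 0 ≤ l)
    (hlc : l < c) {S T : H →L[ℂ] H} (hS : IsFunctionOf A Real.sign S)
    (hT : IsFunctionOf (SkewFredholm.shift A l) Real.sign T) : IsHilbertSchmidt (S - T) := by
  obtain ⟨N, hN⟩ := hA.exists_resolvent_of_im_ne (z := Complex.I) (by simp)
  have hn := hA.isStarNormal hN
  -- The condition r < c makes the range of the bump at 0 finite-dimensional; l < r makes sign t and
  -- sign(t − l) agree once |t| ≥ r.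
  obtain ⟨r, hlr, hrc⟩ := exists_between hlc
  have hr : 0 ≤ r := hl.trans hlr.le
  have hfd := hA.finiteDimensional_range_bumpOp hN hM hr hrc
  have hbc := continuous_bump 0 r
  have hsn : ∀ t : ℝ, ‖(Real.sign t : ℂ)‖ ≤ 1 := fun t => by
    rcases Real.sign_apply_eq t with h | h | h <;> simp [h]
  have hms : Measurable fun t : ℝ => (Real.sign t : ℂ) :=
    Complex.measurable_ofReal.comp measurable_sign
  have hms' : Measurable fun t : ℝ => (Real.sign (t - l) : ℂ) :=
    hms.comp (measurable_id.sub_const l)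
  have hW : ∀ x, inner ℂ x ((S - T) x) = ((∫ w : spectrum ℂ N,
      (Real.sign (coord w) - Real.sign (coord w - l)) ∂(nu hn x) : ℝ) : ℂ) := by
    intro x
    have hμ := isSpectralMeasureAt_mu hA hN x
    rw [sub_apply, inner_sub_right, hA.inner_signOf hμ hS, (hA.shift l).inner_signOf (hμ.shift l) hT,
      integral_map (by fun_prop) hms.aestronglyMeasurable, mu,
      integral_map measurable_coord_subtype.aemeasurable hms.aestronglyMeasurable,
      integral_map measurable_coord_subtype.aemeasurable hms'.aestronglyMeasurable,
      ← integral_sub, ← integral_complex_ofReal]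
    · simp_rw [Complex.ofReal_sub]
    · exact Integrable.mono' (integrable_const 1)
        (hms.comp measurable_coord_subtype).aestronglyMeasurable
        (Eventually.of_forall fun w => hsn _)
    · exact Integrable.mono' (integrable_const 1)
        (hms'.comp measurable_coord_subtype).aestronglyMeasurable
        (Eventually.of_forall fun w => hsn _)
  have hpos : 0 ≤ S - T := by
    rw [ContinuousLinearMap.nonneg_iff_isPositive, ContinuousLinearMap.isPositive_iff_complex]
    intro x
    have h1 : inner ℂ ((S - T) x) x = ((∫ w : spectrum ℂ N,
      (Real.sign (coord w) - Real.sign (coord w - l)) ∂(nu hn x) : ℝ) : ℂ) := by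
      rw [← inner_conj_symm, hW, Complex.conj_ofReal]
    rw [h1]
    refine ⟨by simp, ?_⟩
    rw [RCLike.re_eq_complex_re, Complex.ofReal_re]
    exact integral_nonneg fun w => sign_sub_nonneg hl
  -- S − T is nonnegative, so it kills x as soon as its quadratic form does. If x is orthogonal to
  -- the range of the bump operator, its adjoint kills x, so the spectral measure at x lives on |t|
  -- ≥ r, where the two signs agree.
  refine isHilbertSchmidt_of_eq_zero (LinearMap.range (bumpOp N 0 r).toLinearMap) fun x hx =>
    eq_zero_of_nonneg_of_inner hpos ?_
  have hbx : ContinuousLinearMap.adjoint (bumpOp N 0 r) x = 0 := by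
    rw [← inner_self_eq_zero (𝕜 := ℂ), ContinuousLinearMap.adjoint_inner_right]
    exact (Submodule.mem_orthogonal _ _).1 hx _ ⟨_, rfl⟩
  have hint : ∫ w : spectrum ℂ N, ‖star ((w : ℂ) * bump 0 r w)‖ ^ 2 ∂(nu hn x) = 0 := by
    have hc : Continuous fun w => star (w * bump 0 r w) := by fun_prop
    rw [← norm_cfc_sq hn x hc.continuousOn, cfc_star, ContinuousLinearMap.star_eq_adjoint]
    rw [bumpOp] at hbx
    rw [hbx, norm_zero]
    norm_num
  rw [integral_eq_zero_iff_of_nonneg (fun w => by positivity)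
    (integrable_nu hn x (g := fun w => ‖star (w * bump 0 r w)‖ ^ 2)
      (by fun_prop))] at hint
  rw [hW, integral_eq_zero_of_ae, Complex.ofReal_zero]
  filter_upwards [hint, hA.ae_ne_zero hN x] with w hw hw0
  have h1 : bump 0 r w = 0 := by
    have h2 : ‖star ((w : ℂ) * bump 0 r w)‖ ^ 2 = 0 := hw
    rw [sq_eq_zero_iff, norm_star, norm_eq_zero] at h2
    exact (mul_eq_zero.1 h2).resolve_left hw0
  have h3 : r ≤ |coord w| := by
    by_contra hlt
    refine bump_ne_zero_iff.2 ?_ h1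
    rw [hA.one_add_eq hN w.2 hw0, norm_mul, mul_comm, Complex.ofReal_zero, sub_zero,
      Complex.norm_real, Real.norm_eq_abs]
    exact mul_lt_mul_of_pos_right (not_le.1 hlt) (norm_pos_iff.2 hw0)
  rw [sign_sub_eq (by rw [abs_of_nonneg hl]; linarith), sub_self]
  rfl

/-- Off a further finite-dimensional space Q costs at most c/2 (`IsHilbertSchmidt.exists_small`),
which leaves the lower bound c/2. -/
theorem IsEssBelow.perturb {𝕜 H : Type*} [RCLike 𝕜] [NormedAddCommGroup H] [InnerProductSpace 𝕜 H]
    [CompleteSpace H] {D : H →ₗ.[𝕜] H} {Q : H →L[𝕜] H} (hD : IsEssBelow D)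
    (hQ : IsHilbertSchmidt Q) : IsEssBelow (perturb D Q) := by
  obtain ⟨M, hM, c, hc, h⟩ := hD
  obtain ⟨M', hM', h'⟩ := hQ.exists_small (half_pos hc)
  refine ⟨M ⊔ M', inferInstance, c / 2, half_pos hc, fun x hx => ?_⟩
  have h1 := h x (Submodule.orthogonal_le le_sup_left hx)
  have h2 := h' x (Submodule.orthogonal_le le_sup_right hx)
  rw [perturb_apply]
  have h3 := norm_sub_le (Q x + D x) (Q x)
  rw [add_sub_cancel_left] at h3
  have h4 : c * ‖(x : H)‖ ≤ ‖D x‖ := h1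
  linarith

theorem IsSA.exists_common_gap {A B : H →ₗ.[ℂ] H} (hA : IsSA A) (hB : IsSA B)
    {M M' : Submodule ℂ H} [FiniteDimensional ℂ M] [FiniteDimensional ℂ M'] {c : ℝ} (hc : 0 < c)
    (hM : ∀ x : A.domain, (x : H) ∈ Mᗮ → c * ‖(x : H)‖ ≤ ‖A x‖)
    (hM' : ∀ x : B.domain, (x : H) ∈ M'ᗮ → c * ‖(x : H)‖ ≤ ‖B x‖) :
    ∃ l r : ℝ, 0 < l ∧ l < c ∧ 0 < r ∧ IsBelow A l r ∧ IsBelow B l r := by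
  -- Intervals around `l k` of radius `l k / 4` lie within c/2 of 0 and are disjoint by geometric
  -- decay. Each operator fails its lower bound on only finitely many of them, so some index works
  -- for both.
  let l : ℕ → ℝ := fun k => c / 4 * (1 / 2) ^ k
  have hl : ∀ k, 0 < l k := fun k => by positivity
  have hl4 : ∀ k, l k ≤ c / 4 := fun k =>
    mul_le_of_le_one_right (by positivity) (pow_le_one₀ (by norm_num) (by norm_num))
  have hlr : ∀ k, |l k| + l k / 4 ≤ c / 2 := fun k => by
    rw [abs_of_pos (hl k)]
    linarith [hl4 k]
  have hlt : ∀ j k, j < k → l j / 4 + l k / 4 ≤ |l j - l k| := by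
    intro j k hjk
    have h1 : l k ≤ l j / 2 := by
      have h2 : ((1 : ℝ) / 2) ^ k ≤ (1 / 2) ^ (j + 1) :=
        pow_le_pow_of_le_one (by norm_num) (by norm_num) hjk
      rw [pow_succ] at h2
      have : c / 4 * (1 / 2) ^ k ≤ c / 4 * ((1 / 2) ^ j * (1 / 2)) := by gcongr
      change c / 4 * (1 / 2) ^ k ≤ c / 4 * (1 / 2) ^ j / 2
      linarith
    have h3 := le_abs_self (l j - l k)
    linarith [hl j]
  have hdisj : ∀ j k, j ≠ k → l j / 4 + l k / 4 ≤ |l j - l k| := by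
    intro j k hjk
    rcases lt_or_gt_of_ne hjk with h | h
    · exact hlt j k h
    · rw [add_comm, abs_sub_comm]
      exact hlt k j h
  have hr : ∀ k, 0 ≤ l k / 4 := fun k => by linarith [hl k]
  have hfin := (hA.finite_not_isBelow hc hM hr hlr hdisj).union
    (hB.finite_not_isBelow hc hM' hr hlr hdisj)
  obtain ⟨k, hk⟩ := hfin.exists_notMem
  simp only [Set.mem_union, Set.mem_ofPred_eq, not_or, not_not] at hk
  exact ⟨l k, l k / 4, hl k, by linarith [hl4 k], by linarith [hl k], hk.1, hk.2⟩

/-- With S', T' the signs of A − l and A + K − l for a common gap l, T − S = (T−T') + (T'−S') −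
(S−S'): the outer terms come from moving the jump, the middle one obeys the sharp estimate. -/
theorem IsSA.isHilbertSchmidt_sign_sub {A : H →ₗ.[ℂ] H} {K : H →L[ℂ] H} (hA : IsSA A)
    (hess : IsEssBelow A) (hKa : ContinuousLinearMap.adjoint K = K) (hK : IsHilbertSchmidt K)
    {S T : H →L[ℂ] H} (hS : IsFunctionOf A Real.sign S)
    (hT : IsFunctionOf (SkewFredholm.perturb A K) Real.sign T) : IsHilbertSchmidt (T - S) := by
  have hB := hA.perturb hKa
  obtain ⟨M', hMf', c', hc', hM'⟩ := hess.perturb hK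
  obtain ⟨M, hMf, c, hc, hM⟩ := hess
  obtain ⟨l, r, hl, hlc, hr, h1, h2⟩ := hA.exists_common_gap hB (c := min c c') (lt_min hc hc')
    (M := M) (M' := M')
    (fun x hx => (mul_le_mul_of_nonneg_right (min_le_left _ _) (norm_nonneg _)).trans (hM x hx))
    (fun x hx => (mul_le_mul_of_nonneg_right (min_le_right _ _) (norm_nonneg _)).trans (hM' x hx))
  obtain ⟨S', hS'⟩ := (hA.shift l).exists_isFunctionOf_sign
  obtain ⟨T', hT'⟩ := (hB.shift l).exists_isFunctionOf_sign
  have e1 := hA.isHilbertSchmidt_sign_sub_shift hM hl.le (hlc.trans_le (min_le_left _ _)) hS hS'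
  have e2 := hB.isHilbertSchmidt_sign_sub_shift hM' hl.le (hlc.trans_le (min_le_right _ _)) hT hT'
  have e3 : IsHilbertSchmidt (T' - S') := by
    have hcomm : SkewFredholm.shift (SkewFredholm.perturb A K) l =
        SkewFredholm.perturb (SkewFredholm.shift A l) K := perturb_perturb A K _
    have hB' := hB.shift l
    have h2' := h2.shift
    rw [hcomm] at hB' hT' h2'
    refine ((hA.shift l).hsNorm_sign_sub_le hB' hK hr h1.shift h2' hS' hT').trans_lt ?_
    exact ENNReal.div_lt_top hK.ne (by simpa using hr)
  have : T - S = (T - T') + (T' - S') - (S - S') := by abel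
  rw [this]
  exact (e2.add e3).sub e1

end Shift

end SkewFredholm

namespace SkewFredholm

/-! ### Fredholm operators are bounded below off a finite-dimensional space -/

section Fredholm

open Filter Topology

variable {𝕜 H : Type*} [RCLike 𝕜] [NormedAddCommGroup H] [InnerProductSpace 𝕜 H] [CompleteSpace H]

theorem IsSkew.mem_of_tendsto {𝕜 H : Type*} [RCLike 𝕜] [NormedAddCommGroup H]
    [InnerProductSpace 𝕜 H] {D : H →ₗ.[𝕜] H} (hD : IsSkew D) {u : ℕ → D.domain} {x y : H}
    (hx : Tendsto (fun n => (u n : H)) atTop (𝓝 x)) (hy : Tendsto (fun n => D (u n)) atTop (𝓝 y)) :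
    ∃ h : x ∈ D.domain, D ⟨x, h⟩ = y :=
  hD.maximal x y fun w => by
    refine tendsto_nhds_unique (f := fun n => inner 𝕜 (u n : H) (D w))
      (hx.inner tendsto_const_nhds) ?_
    have h : ∀ n, inner 𝕜 (u n : H) (D w) = -inner 𝕜 (D (u n)) (w : H) := fun n => by
      rw [hD.skew, neg_neg]
    simp_rw [h]
    exact (hy.inner tendsto_const_nhds).neg

/-- With M the kernel, D restricts to a bijection from its domain within Mᗮ onto the closed range.
The closed graph theorem bounds the inverse. -/
theorem IsFredholmOp.isEssBelow {D : H →ₗ.[𝕜] H} (hF : IsFredholmOp D) (hD : IsSkew D) :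
    IsEssBelow D := by
  have hfk := hF.finite_ker
  let M : Submodule 𝕜 H := (LinearMap.ker D.toFun).map D.domain.subtype
  have hM : FiniteDimensional 𝕜 M := inferInstance
  have hMD : ∀ m ∈ M, ∃ h : m ∈ D.domain, D ⟨m, h⟩ = 0 := by
    rintro _ ⟨m, hm, rfl⟩
    exact ⟨m.2, hm⟩
  let W : Submodule 𝕜 D.domain := Mᗮ.comap D.domain.subtype
  let L : W →ₗ[𝕜] LinearMap.range D.toFun := D.toFun.rangeRestrict ∘ₗ W.subtype
  have hL : ∀ w : W, (L w : H) = D w := fun _ => rfl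
  have hinj : Function.Injective L := by
    rw [injective_iff_map_eq_zero]
    intro w hw
    have h1 : D w = 0 := congrArg Subtype.val hw
    have h2 : ((w : D.domain) : H) ∈ M := ⟨w, h1, rfl⟩
    have h3 : ((w : D.domain) : H) ∈ Mᗮ := w.2
    exact Subtype.ext (Subtype.ext (inner_self_eq_zero.1
      ((Submodule.mem_orthogonal _ _).1 h3 _ h2)))
  have hsurj : Function.Surjective L := by
    rintro ⟨_, x, rfl⟩
    obtain ⟨h1, h2⟩ := hMD (M.starProjection x) (M.starProjection_apply_mem x)
    refine ⟨⟨x - ⟨_, h1⟩, M.sub_starProjection_mem_orthogonal x⟩, Subtype.ext ?_⟩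
    rw [hL]
    change D (x - ⟨_, h1⟩) = D x
    rw [D.map_sub, h2, sub_zero]
  let e := LinearEquiv.ofBijective L ⟨hinj, hsurj⟩
  have he : ∀ y, D (e.symm y : D.domain) = (y : H) := fun y =>
    congrArg Subtype.val (e.apply_symm_apply y)
  let G : LinearMap.range D.toFun →ₗ[𝕜] H :=
    D.domain.subtype ∘ₗ W.subtype ∘ₗ e.symm.toLinearMap
  have : CompleteSpace (LinearMap.range D.toFun) :=
    completeSpace_coe_iff_isComplete.2 hF.isClosed_range.isComplete
  have hG : Continuous G := by
    refine G.continuous_of_seq_closed_graph fun u y x hu hx => ?_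
    obtain ⟨h1, h2⟩ := hD.mem_of_tendsto (u := fun n => (e.symm (u n) : D.domain)) (x := x)
      (y := (y : H)) hx (by
        simp_rw [he]
        exact (continuous_subtype_val.tendsto _).comp hu)
    have h3 : x ∈ Mᗮ := M.isClosed_orthogonal.mem_of_tendsto hx
      (Eventually.of_forall fun n => (e.symm (u n)).2)
    have h4 : e ⟨⟨x, h1⟩, h3⟩ = y := Subtype.ext h2
    rw [← h4]
    change x = ((e.symm (e _) : D.domain) : H)
    rw [e.symm_apply_apply]
  let G' : LinearMap.range D.toFun →L[𝕜] H := ⟨G, hG⟩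
  refine ⟨M, hM, (‖G'‖ + 1)⁻¹, by positivity, fun x hx => ?_⟩
  rw [inv_mul_le_iff₀ (by positivity)]
  have h1 : G' (e ⟨x, hx⟩) = x := by
    change ((e.symm (e _) : D.domain) : H) = _
    rw [e.symm_apply_apply]
  calc ‖(x : H)‖ = ‖G' (e ⟨x, hx⟩)‖ := by rw [h1]
    _ ≤ ‖G'‖ * ‖D x‖ := G'.le_opNorm _
    _ ≤ _ := by gcongr; linarith

end Fredholm

/-! ### The complex case -/

section Complex

open Filter Topology

variable {H : Type*} [NormedAddCommGroup H] [InnerProductSpace ℂ H]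

theorem overI_perturb (D : H →ₗ.[ℂ] H) (Q : H →L[ℂ] H) :
    overI (perturb D Q) = perturb (overI D) ((1 / Complex.I) • Q) := by
  refine LinearPMap.ext rfl fun x h1 h2 => ?_
  change (1 / Complex.I) • (Q x + D ⟨x, h1⟩) = (1 / Complex.I) • Q x + (1 / Complex.I) • D ⟨x, h1⟩
  rw [smul_add]

theorem IsEssBelow.overI {D : H →ₗ.[ℂ] H} (hD : IsEssBelow D) : IsEssBelow (overI D) := by
  obtain ⟨M, hM, c, hc, h⟩ := hD
  refine ⟨M, hM, c, hc, fun x hx => (h x hx).trans_eq ?_⟩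
  rw [overI_apply, norm_smul]
  simp

theorem isResolventAt_overI {D : H →ₗ.[ℂ] H} {z : ℂ} {R : H →L[ℂ] H} :
    IsResolventAt (overI D) z (Complex.I • R) ↔ IsResolventAt D (Complex.I * z) R := by
  have hI : (1 / Complex.I) * Complex.I = 1 := by simp
  have e : ∀ y : D.domain, overI D y - z • (y : H) =
      (1 / Complex.I) • (D y - (Complex.I * z) • (y : H)) := fun y => by
    change (1 / Complex.I) • D y - z • (y : H) = _
    rw [smul_sub, smul_smul, ← mul_assoc, hI, one_mul]
  constructor
  · rintro ⟨h1, h2⟩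
    refine ⟨fun x => ?_, fun y => ?_⟩
    · obtain ⟨h, hx⟩ := h1 x
      have h' : R x ∈ D.domain := by
        have := D.domain.smul_mem (1 / Complex.I) h
        rwa [smul_apply, smul_smul, hI, one_smul] at this
      refine ⟨h', ?_⟩
      have h3 := e (Complex.I • ⟨R x, h'⟩)
      rw [D.map_smul] at h3
      have h4 := h3.symm.trans hx
      rw [SetLike.val_smul, smul_comm _ Complex.I (R x), ← smul_sub, smul_smul, hI, one_smul] at h4
      exact h4
    · have := h2 y
      rw [e, smul_apply, map_smul, smul_smul, mul_comm, hI, one_smul] at this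
      exact this
  · rintro ⟨h1, h2⟩
    refine ⟨fun x => ?_, fun y => ?_⟩
    · obtain ⟨h, hx⟩ := h1 x
      refine ⟨D.domain.smul_mem _ h, ?_⟩
      refine (e (Complex.I • ⟨R x, h⟩)).trans ?_
      rw [D.map_smul, SetLike.val_smul, smul_comm _ Complex.I (R x), ← smul_sub, smul_smul, hI,
        one_smul, hx]
    · refine (congrArg (Complex.I • R) (e y)).trans ?_
      rw [smul_apply, map_smul, smul_smul, mul_comm, hI, one_smul]
      exact h2 y

theorem exists_resolvent_overI {D : H →ₗ.[ℂ] H} {z : ℂ} :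
    (∃ R, IsResolventAt (overI D) z R) ↔ Complex.I * z ∉ spectrumOp D := by
  rw [spectrumOp, Set.mem_ofPred_eq, not_not]
  constructor
  · rintro ⟨R, hR⟩
    refine ⟨(1 / Complex.I) • R, isResolventAt_overI.1 ?_⟩
    rwa [smul_smul, show Complex.I * (1 / Complex.I) = 1 by simp, one_smul]
  · rintro ⟨R, hR⟩
    exact ⟨_, isResolventAt_overI.2 hR⟩

variable [CompleteSpace H]

/-- The resolvent at 0 gives a lower bound c, which stays positive at every point of modulus less
than c; for self-adjoint operators a positive lower bound already yields a resolvent. -/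
theorem IsSkew.exists_ball {D : H →ₗ.[ℂ] H} (hD : IsSkew D) (h0 : (0 : ℂ) ∉ spectrumOp D) :
    ∃ c : ℝ, 0 < c ∧ ∀ z ∈ spectrumOp D, c ≤ ‖z‖ := by
  have hA := hD.isSA
  obtain ⟨R, hR⟩ := (exists_resolvent_overI (D := D) (z := 0)).2 (by rwa [mul_zero])
  obtain ⟨c, hc, hb⟩ := hR.isBelow
  refine ⟨c, hc, fun z hz => ?_⟩
  by_contra! hlt
  have h1 := hb.add (u := -Complex.I * z)
  rw [zero_add, norm_mul, norm_neg, Complex.norm_I, one_mul] at h1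
  have h2 := (exists_resolvent_overI (D := D)).1 (hA.exists_resolvent (sub_pos.2 hlt) h1)
  rw [← mul_assoc, mul_neg, Complex.I_mul_I, neg_neg, one_mul] at h2
  exact h2 hz

theorem IsSkew.isBelow_of_infEDist {D : H →ₗ.[ℂ] H} (hD : IsSkew D) {s : Set ℂ}
    (hs : spectrumOp D ⊆ s) {a : ℝ} (ha : 0 ≤ a) (h : ENNReal.ofReal a ≤ Metric.infEDist 0 s) :
    IsBelow (overI D) 0 a := by
  refine hD.isSA.isBelow_of_resolvent ha fun l hl => ?_
  rw [exists_resolvent_overI]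
  intro hmem
  have h1 := h.trans (Metric.infEDist_le_edist_of_mem (hs hmem))
  rw [edist_comm, edist_zero_right, ← ofReal_norm, norm_mul, Complex.norm_I, one_mul,
    Complex.norm_real, Real.norm_eq_abs,
    ENNReal.ofReal_le_ofReal_iff (abs_nonneg l)] at h1
  exact absurd hl (not_lt.2 h1)

theorem skew_smul {Q : H →L[ℂ] H} (hQ : ContinuousLinearMap.adjoint Q = -Q) :
    ContinuousLinearMap.adjoint ((1 / Complex.I) • Q) = (1 / Complex.I) • Q := by
  rw [← ContinuousLinearMap.star_eq_adjoint] at *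
  rw [star_smul, hQ]
  simp

/-- Passes from real lower bounds b to an extended distance a. If X ≠ 0 then a ≤ Q/X, which rules
out a = ∞; thus an infinite a forces X = 0. -/
theorem le_div_of_forall_lt {X Q a : ℝ≥0∞} (ha : a ≠ 0) (hX : X ≠ ∞) (hQ : Q ≠ ∞)
    (h : ∀ b : ℝ, 0 < b → ENNReal.ofReal b ≤ a → X ≤ Q / ENNReal.ofReal b) : X ≤ Q / a := by
  rcases eq_or_ne X 0 with rfl | hX0
  · exact zero_le
  · have h1 : a ≤ Q / X := by
      refine le_of_forall_lt_imp_le_of_dense fun b hb => ?_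
      rcases eq_or_ne b 0 with rfl | hb0
      · exact zero_le
      · have hbt : b ≠ ∞ := hb.ne_top
        have h2 := h b.toReal (ENNReal.toReal_pos hb0 hbt)
        rw [ENNReal.ofReal_toReal hbt] at h2
        have h3 := h2 hb.le
        rw [ENNReal.le_div_iff_mul_le (Or.inl hb0) (Or.inl hbt)] at h3
        rw [ENNReal.le_div_iff_mul_le (Or.inl hX0) (Or.inl hX), mul_comm]
        exact h3
    rw [ENNReal.le_div_iff_mul_le (Or.inl hX0) (Or.inl hX)] at h1
    rcases eq_or_ne a ∞ with rfl | hat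
    · rw [ENNReal.top_mul hX0, top_le_iff] at h1
      exact absurd h1 hQ
    · rw [ENNReal.le_div_iff_mul_le (Or.inl ha) (Or.inl hat), mul_comm]
      exact h1

theorem IsSkew.existsUnique_sign {D : H →ₗ.[ℂ] H} (hD : IsSkew D) :
    ∃! S, IsFunctionOf (overI D) Real.sign S := hD.isSA.existsUnique_sign

theorem skewSign_sub {H : Type*} [NormedAddCommGroup H] [InnerProductSpace ℂ H] (D E : H →ₗ.[ℂ] H) : skewSign E - skewSign D =
    Complex.I • (functionOf (overI E) Real.sign - functionOf (overI D) Real.sign) := by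
  rw [skewSign, skewSign, smul_sub]

theorem IsSkew.isHilbertSchmidt_skewSign_sub {D : H →ₗ.[ℂ] H} (hD : IsSkew D)
    (hess : IsEssBelow D) {Q : H →L[ℂ] H} (hQ : ContinuousLinearMap.adjoint Q = -Q)
    (hQ2 : IsHilbertSchmidt Q) : IsHilbertSchmidt (skewSign (SkewFredholm.perturb D Q) - skewSign D) := by
  have hK : IsHilbertSchmidt ((1 / Complex.I) • Q) := by
    rwa [IsHilbertSchmidt, hsNorm_smul_of_norm_one (by simp)]
  have hT := (hD.perturb hQ).isSA.isFunctionOf_functionOf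
  rw [IsHilbertSchmidt, skewSign_sub, hsNorm_smul_of_norm_one (by simp)]
  refine hD.isSA.isHilbertSchmidt_sign_sub hess.overI (skew_smul hQ) hK
    hD.isSA.isFunctionOf_functionOf ?_
  rwa [← overI_perturb]

theorem IsSkew.hsNorm_skewSign_sub_le {D : H →ₗ.[ℂ] H} (hD : IsSkew D)
    (hess : IsEssBelow D) {Q : H →L[ℂ] H} (hQ : ContinuousLinearMap.adjoint Q = -Q)
    (hQ2 : IsHilbertSchmidt Q) {a : ℝ≥0∞}
    (ha : a = Metric.infEDist (0 : ℂ) (spectrumOp D ∪ spectrumOp (SkewFredholm.perturb D Q)))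
    (h1 : (0 : ℂ) ∉ spectrumOp D) (h2 : (0 : ℂ) ∉ spectrumOp (SkewFredholm.perturb D Q)) :
    0 < a ∧ hsNorm (skewSign (SkewFredholm.perturb D Q) - skewSign D) ≤ hsNorm Q / a := by
  have hE := hD.perturb hQ
  have hpos : 0 < a := by
    obtain ⟨c, hc, hcD⟩ := hD.exists_ball h1
    obtain ⟨d, hd, hdE⟩ := hE.exists_ball h2
    refine (ENNReal.ofReal_pos.2 (lt_min hc hd)).trans_le ?_
    rw [ha, Metric.le_infEDist]
    intro z hz
    rw [edist_comm, edist_zero_right, ← ofReal_norm]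
    refine ENNReal.ofReal_le_ofReal ?_
    rcases hz with hz | hz
    · exact (min_le_left _ _).trans (hcD z hz)
    · exact (min_le_right _ _).trans (hdE z hz)
  refine ⟨hpos, le_div_of_forall_lt hpos.ne'
    (hD.isHilbertSchmidt_skewSign_sub hess hQ hQ2).ne hQ2.ne fun b hb hba => ?_⟩
  have hK : hsNorm ((1 / Complex.I) • Q) = hsNorm Q := hsNorm_smul_of_norm_one (by simp) Q
  rw [ha] at hba
  have hB1 := hD.isBelow_of_infEDist Set.subset_union_left hb.le hba
  have hB2 := hE.isBelow_of_infEDist Set.subset_union_right hb.le hba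
  have hT := hE.isSA.isFunctionOf_functionOf
  have hE' := hE.isSA
  rw [skewSign_sub, hsNorm_smul_of_norm_one (by simp), ← hK]
  have e := overI_perturb D Q
  rw [e] at hB2 hE'
  refine hD.isSA.hsNorm_sign_sub_le hE' (by rwa [IsHilbertSchmidt, hK]) hb hB1 hB2
    hD.isSA.isFunctionOf_functionOf ?_
  rwa [← e]

end Complex

end SkewFredholm

namespace SkewFredholm

open Filter Topology MeasureTheory

/-! ### The real case by complexification -/

namespace Complexification

variable {V : Type*} [NormedAddCommGroup V]

@[simp] theorem re_neg (x : Complexification V) : (-x).re = -x.re := rfl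

@[simp] theorem im_neg (x : Complexification V) : (-x).im = -x.im := rfl

@[simp] theorem re_sub (x y : Complexification V) : (x - y).re = x.re - y.re := rfl

@[simp] theorem im_sub (x y : Complexification V) : (x - y).im = x.im - y.im := rfl

theorem norm_mk_zero (v : V) : ‖mk v 0‖ = ‖v‖ := by
  rw [← sq_eq_sq₀ (norm_nonneg _) (norm_nonneg _), norm_sq]
  simp

/-- Complex conjugation `x + i y ↦ x - i y`. -/
def conj (x : Complexification V) : Complexification V := mk x.re (-x.im)

@[simp] theorem re_conj (x : Complexification V) : (conj x).re = x.re := rfl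

@[simp] theorem im_conj (x : Complexification V) : (conj x).im = -x.im := rfl

@[simp] theorem conj_conj (x : Complexification V) : conj (conj x) = x := by ext <;> simp

theorem conj_add (x y : Complexification V) : conj (x + y) = conj x + conj y := by
  ext <;> simp [add_comm]

theorem conj_neg (x : Complexification V) : conj (-x) = -conj x := by ext <;> simp

theorem conj_sub (x y : Complexification V) : conj (x - y) = conj x - conj y := by
  rw [sub_eq_add_neg, conj_add, conj_neg, sub_eq_add_neg]

theorem continuous_conj : Continuous (conj : Complexification V → Complexification V) :=
  continuous_mk continuous_re continuous_im.neg

variable [InnerProductSpace ℝ V]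

theorem inner_re (x y : Complexification V) :
    (inner ℂ x y).re = inner ℝ x.re y.re + inner ℝ x.im y.im := rfl

theorem inner_im (x y : Complexification V) :
    (inner ℂ x y).im = inner ℝ x.re y.im - inner ℝ x.im y.re := rfl

@[simp] theorem mapL_apply (T : V →L[ℝ] V) (x : Complexification V) :
    mapL T x = mk (T x.re) (T x.im) := rfl

theorem mapP_apply (D : V →ₗ.[ℝ] V) (x : (mapP D).domain) :
    mapP D x = mk (D ⟨x.1.re, x.2.1⟩) (D ⟨x.1.im, x.2.2⟩) := rfl

theorem mapL_sub (S T : V →L[ℝ] V) : mapL (S - T) = mapL S - mapL T := by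
  ext x <;> simp [sub_apply]

theorem mapP_perturb (D : V →ₗ.[ℝ] V) (Q : V →L[ℝ] V) :
    mapP (perturb D Q) = perturb (mapP D) (mapL Q) :=
  LinearPMap.ext rfl fun _ _ _ => rfl

theorem isSkew_mapP {D : V →ₗ.[ℝ] V} (hD : IsSkew D) : IsSkew (mapP D) := by
  refine ⟨fun x => ?_, fun x y => ?_, fun x z h => ?_⟩
  · obtain ⟨u, hu, hux⟩ := mem_closure_iff_seq_limit.1 (hD.dense x.re)
    obtain ⟨v, hv, hvx⟩ := mem_closure_iff_seq_limit.1 (hD.dense x.im)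
    refine mem_closure_iff_seq_limit.2 ⟨fun n => mk (u n) (v n), fun n => ⟨hu n, hv n⟩, ?_⟩
    have hc : Continuous fun p : V × V => mk p.1 p.2 := continuous_mk continuous_fst continuous_snd
    exact (hc.tendsto (x.re, x.im)).comp (hux.prodMk_nhds hvx)
  · have h := fun (a b : V) (ha : a ∈ D.domain) (hb : b ∈ D.domain) => hD.skew ⟨a, ha⟩ ⟨b, hb⟩
    apply Complex.ext
    · rw [Complex.neg_re, inner_re, inner_re, mapP_apply, mapP_apply, re_mk, im_mk, re_mk, im_mk,
        h _ _ _ y.2.1, h _ _ _ y.2.2]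
      ring
    · rw [Complex.neg_im, inner_im, inner_im, mapP_apply, mapP_apply, re_mk, im_mk, re_mk, im_mk,
        h _ _ _ y.2.2, h _ _ _ y.2.1]
      ring
  · have h' : ∀ w : D.domain, inner ℂ x (mk (D w) (D 0)) = -inner ℂ z (mk (w : V) 0) :=
      fun w => h ⟨mk w 0, w.2, D.domain.zero_mem⟩
    simp only [D.map_zero] at h'
    obtain ⟨h1, h2⟩ := hD.maximal x.re z.re fun w => by
      have := congrArg Complex.re (h' w)
      simpa [inner_re] using this
    obtain ⟨h3, h4⟩ := hD.maximal x.im z.im fun w => by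
      have := congrArg Complex.im (h' w)
      simp [inner_im] at this
      linarith
    refine ⟨⟨h1, h3⟩, ?_⟩
    rw [mapP_apply]
    exact ext h2 h4

/-- Orthogonality to the complex span of M forces both parts of x into Mᗮ; the two real bounds add
up with the same c. -/
theorem isEssBelow_mapP {D : V →ₗ.[ℝ] V} (hD : IsEssBelow D) : IsEssBelow (mapP D) := by
  obtain ⟨M, hM, c, hc, h⟩ := hD
  let b := Module.finBasis ℝ M
  refine ⟨Submodule.span ℂ (Set.range fun k => mk (b k : V) 0),
    FiniteDimensional.span_of_finite ℂ (Set.finite_range _), c, hc, fun x hx => ?_⟩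
  have h0 : ∀ k, inner ℂ (mk (b k : V) 0) (x : Complexification V) = 0 := fun k =>
    (Submodule.mem_orthogonal _ _).1 hx _ (Submodule.subset_span ⟨k, rfl⟩)
  have hspan : ∀ v : V, (∀ k, inner ℝ (b k : V) v = 0) → v ∈ Mᗮ := by
    intro v hv
    rw [Submodule.mem_orthogonal]
    intro u hu
    have h1 := b.sum_repr ⟨u, hu⟩
    have h2 : u = ∑ k, b.repr ⟨u, hu⟩ k • (b k : V) := by
      have h3 := congrArg M.subtype h1
      rw [map_sum] at h3
      exact h3.symm
    rw [h2, sum_inner]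
    refine Finset.sum_eq_zero fun k _ => ?_
    rw [inner_smul_left, hv, mul_zero]
  have h1 := h ⟨x.1.re, x.2.1⟩ (hspan _ fun k => by
    simpa [inner_re] using congrArg Complex.re (h0 k))
  have h2 := h ⟨x.1.im, x.2.2⟩ (hspan _ fun k => by
    simpa [inner_im] using congrArg Complex.im (h0 k))
  rw [← sq_le_sq₀ (by positivity) (norm_nonneg _), mul_pow, norm_sq, norm_sq, mapP_apply, mul_add,
    ← mul_pow, ← mul_pow]
  exact add_le_add (pow_le_pow_left₀ (by positivity) h1 2) (pow_le_pow_left₀ (by positivity) h2 2)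

theorem adjoint_mapL [CompleteSpace V] {Q : V →L[ℝ] V}
    (hQ : ContinuousLinearMap.adjoint Q = -Q) :
    ContinuousLinearMap.adjoint (mapL Q) = -mapL Q := by
  symm
  rw [ContinuousLinearMap.eq_adjoint_iff]
  intro x y
  have hq : ∀ u v : V, inner ℝ (Q u) v = -inner ℝ u (Q v) := fun u v => by
    rw [← ContinuousLinearMap.adjoint_inner_right, hQ]
    simp
  apply Complex.ext
  · simp [inner_re, hq, add_comm]
  · simp [inner_im, hq]
    ring

/-- A real orthonormal basis of V is also a complex orthonormal basis of the complexification, and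
both norms are computed in it. -/
theorem hsNorm_mapL [CompleteSpace V] (T : V →L[ℝ] V) : hsNorm (mapL T) = hsNorm T := by
  let b := basis ℝ V
  let v : basisSet ℝ V → Complexification V := fun i => mk (b i) 0
  have hv : Orthonormal ℂ v := by
    have hb := b.orthonormal
    refine ⟨fun i => (norm_mk_zero _).trans (hb.1 i), fun i j hij => ?_⟩
    apply Complex.ext
    · simpa [inner_re, v] using hb.2 hij
    · simp [inner_im, v]
  have hsp : (Submodule.span ℂ (Set.range v))ᗮ = ⊥ := by
    rw [Submodule.eq_bot_iff]
    intro x hx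
    have h0 : ∀ i, inner ℂ (v i) x = 0 := fun i =>
      (Submodule.mem_orthogonal _ _).1 hx _ (Submodule.subset_span ⟨i, rfl⟩)
    have hzero : ∀ u : V, (∀ i, inner ℝ (b i) u = 0) → u = 0 := by
      intro u hu
      apply b.repr.injective
      ext i
      rw [b.repr_apply_apply, hu, map_zero]
      rfl
    refine ext (hzero _ fun i => ?_) (hzero _ fun i => ?_)
    · simpa [inner_re, v] using congrArg Complex.re (h0 i)
    · simpa [inner_im, v] using congrArg Complex.im (h0 i)
  let c := HilbertBasis.mkOfOrthogonalEqBot hv hsp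
  have hc : ∀ i, c i = v i := fun i => by rw [HilbertBasis.coe_mkOfOrthogonalEqBot]
  rw [hsNorm, hsNorm, hsNormSq_eq_tsum c, hsNormSq]
  congr 1
  refine tsum_congr fun i => ?_
  rw [hc, mapL_apply]
  simp only [v, re_mk, im_mk, map_zero]
  rw [← ofReal_norm, norm_mk_zero, ofReal_norm]

theorem conj_smul (c : ℂ) (x : Complexification V) :
    conj (c • x) = starRingEnd ℂ c • conj x := by
  ext <;> simp [add_comm]

theorem inner_conj_right (x y : Complexification V) :
    inner ℂ x (conj y) = starRingEnd ℂ (inner ℂ (conj x) y) := by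
  apply Complex.ext
  · rw [Complex.conj_re, inner_re, inner_re]
    simp
  · rw [Complex.conj_im, inner_im, inner_im]
    simp
    ring

/-- Conjugation of a bounded operator by complex conjugation. -/
noncomputable def conjOp (T : Complexification V →L[ℂ] Complexification V) :
    Complexification V →L[ℂ] Complexification V where
  toFun x := conj (T (conj x))
  map_add' x y := by rw [conj_add, map_add, conj_add]
  map_smul' c x := by rw [conj_smul, map_smul, conj_smul]; simp
  cont := continuous_conj.comp (T.continuous.comp continuous_conj)

theorem conjOp_apply (T : Complexification V →L[ℂ] Complexification V) (x : Complexification V) :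
    conjOp T x = conj (T (conj x)) := rfl

theorem conj_mem {D : V →ₗ.[ℝ] V} {x : Complexification V} (hx : x ∈ (overI (mapP D)).domain) :
    conj x ∈ (overI (mapP D)).domain := ⟨hx.1, D.domain.neg_mem hx.2⟩

/-- The extension of D commutes with conjugation, but the scalar 1/i changes sign under it. -/
theorem overI_mapP_conj (D : V →ₗ.[ℝ] V) (x : Complexification V)
    (hx : x ∈ (overI (mapP D)).domain) :
    overI (mapP D) ⟨conj x, conj_mem hx⟩ = -conj (overI (mapP D) ⟨x, hx⟩) := by
  have h1 : mapP D ⟨conj x, conj_mem hx⟩ = conj (mapP D ⟨x, hx⟩) :=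
    ext rfl (D.map_neg ⟨x.im, hx.2⟩)
  change (1 / Complex.I) • mapP D ⟨conj x, conj_mem hx⟩ = -conj ((1 / Complex.I) • mapP D ⟨x, hx⟩)
  rw [h1, conj_smul, ← neg_smul]
  simp

theorem isResolventAt_conjOp {D : V →ₗ.[ℝ] V} {z : ℂ}
    {R : Complexification V →L[ℂ] Complexification V}
    (hR : IsResolventAt (overI (mapP D)) (-starRingEnd ℂ z) R) :
    IsResolventAt (overI (mapP D)) z (-conjOp R) := by
  refine ⟨fun x => ?_, fun y => ?_⟩
  · obtain ⟨h, hx⟩ := hR.1 (conj x)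
    refine ⟨Submodule.neg_mem _ (conj_mem h), ?_⟩
    have h1 : overI (mapP D) ⟨(-conjOp R) x, Submodule.neg_mem _ (conj_mem h)⟩ =
        -overI (mapP D) ⟨conj (R (conj x)), conj_mem h⟩ :=
      (overI (mapP D)).map_neg ⟨conj (R (conj x)), conj_mem h⟩
    rw [h1, overI_mapP_conj D _ h, neg_neg, sub_eq_iff_eq_add.1 hx, conj_add, conj_conj, conj_smul,
      neg_apply, conjOp_apply]
    simp
  · have h := hR.2 ⟨conj y, conj_mem y.2⟩
    rw [overI_mapP_conj D _ y.2] at h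
    have h1 : -conj (overI (mapP D) y) - -starRingEnd ℂ z • conj (y : Complexification V) =
        -conj (overI (mapP D) y - z • (y : Complexification V)) := by
      rw [conj_sub, conj_smul]
      module
    change R (-conj (overI (mapP D) y) - -starRingEnd ℂ z • conj (y : Complexification V)) =
      conj (y : Complexification V) at h
    rw [h1, map_neg] at h
    rw [neg_apply, conjOp_apply, ← conj_neg, h, conj_conj]

/-- Conjugation anticommutes with (1/i)D, so reflecting a spectral measure at `conj x` through t ↦
−t gives one at x. Oddness of the sign absorbs the minus. -/
theorem isFunctionOf_conjOp {D : V →ₗ.[ℝ] V} {S : Complexification V →L[ℂ] Complexification V}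
    (hS : IsFunctionOf (overI (mapP D)) Real.sign S) :
    IsFunctionOf (overI (mapP D)) Real.sign (-conjOp S) := by
  intro x
  obtain ⟨μ, hμ, hx⟩ := hS (conj x)
  have := hμ.1
  refine ⟨μ.map fun t => -t, ⟨Measure.isFiniteMeasure_map _ _, fun z hz => ?_⟩, ?_⟩
  · obtain ⟨R, hR, hRx⟩ := hμ.2 (-starRingEnd ℂ z) (by simpa using hz)
    have hm : Measurable fun t : ℝ => ((t : ℂ) - z)⁻¹ :=
      (Complex.measurable_ofReal.sub_const z).inv
    refine ⟨_, isResolventAt_conjOp hR, ?_⟩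
    rw [neg_apply, inner_neg_right, conjOp_apply, inner_conj_right, hRx, ← integral_conj,
      integral_map (by fun_prop) hm.aestronglyMeasurable, ← integral_neg]
    refine integral_congr_ae (Eventually.of_forall fun t => ?_)
    simp only [map_inv₀, map_sub, map_neg, Complex.conj_ofReal, Complex.conj_conj]
    rw [← inv_neg]
    congr 1
    push_cast
    ring
  · have hms : Measurable fun t : ℝ => (Real.sign t : ℂ) :=
      Complex.measurable_ofReal.comp measurable_sign
    rw [neg_apply, inner_neg_right, conjOp_apply, inner_conj_right, hx, ← integral_conj,
      integral_map (by fun_prop) hms.aestronglyMeasurable, ← integral_neg]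
    refine integral_congr_ae (Eventually.of_forall fun t => ?_)
    simp only [Complex.conj_ofReal, Real.sign_neg, Complex.ofReal_neg]

theorem mk_add_I_smul (x : Complexification V) : x = mk x.re 0 + Complex.I • mk x.im 0 := by
  ext <;> simp

/-- An operator commuting with complex conjugation is real. -/
theorem exists_mapL_eq {T : Complexification V →L[ℂ] Complexification V} (hT : conjOp T = T) :
    ∃ J : V →L[ℝ] V, mapL J = T := by
  have him : ∀ v : V, (T (mk v 0)).im = 0 := fun v => by
    have h1 : conj (T (conj (mk v 0))) = T (mk v 0) := by rw [← conjOp_apply, hT]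
    have h2 : conj (mk v 0) = mk v 0 := by ext <;> simp
    rw [h2] at h1
    have h3 := congrArg im h1
    rw [im_conj] at h3
    have h4 : (2 : ℝ) • (T (mk v 0)).im = 0 := by
      rw [two_smul]
      nth_rewrite 1 [← h3]
      exact neg_add_cancel _
    exact (smul_eq_zero.1 h4).resolve_left two_ne_zero
  let J : V →L[ℝ] V :=
    { toFun := fun v => (T (mk v 0)).re
      map_add' := fun u v => by
        have : mk (u + v) 0 = mk u 0 + mk v 0 := by ext <;> simp
        rw [this, map_add, re_add]
      map_smul' := fun c v => by
        have : mk (c • v) 0 = (c : ℂ) • mk v 0 := by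
          ext
          · rw [re_smul]
            simp
          · rw [im_smul]
            simp
        rw [this, map_smul, re_smul]
        simp
      cont := continuous_re.comp (T.continuous.comp (continuous_mk continuous_id continuous_const)) }
  have hJ : ∀ v, T (mk v 0) = mk (J v) 0 := fun v => ext rfl (him v)
  refine ⟨J, ?_⟩
  refine ContinuousLinearMap.ext fun x => ?_
  conv_rhs => rw [mk_add_I_smul x, map_add, map_smul, hJ, hJ]
  rw [mapL_apply, mk_add_I_smul (mk (J x.re) (J x.im))]
  rfl

/-- By uniqueness −C S C = S for S the sign and C the conjugation; since C also sends i to −i, the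
operator iS commutes with C and is therefore real. -/
theorem mapL_realSkewSign [CompleteSpace V] {D : V →ₗ.[ℝ] V} (hD : IsSkew D) :
    mapL (realSkewSign D) = skewSign (mapP D) := by
  have hA := (isSkew_mapP hD).isSA
  have hS := hA.isFunctionOf_functionOf
  have h1 := hA.existsUnique_sign.unique (isFunctionOf_conjOp hS) hS
  have h2 : ∃ J : V →L[ℝ] V, mapL J = skewSign (mapP D) := by
    refine exists_mapL_eq (ContinuousLinearMap.ext fun x => ?_)
    rw [skewSign]
    conv_rhs => rw [← h1]
    rw [conjOp_apply, smul_apply, conj_smul, smul_apply, neg_apply, conjOp_apply, Complex.conj_I,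
      neg_smul, smul_neg]
  rw [realSkewSign, dif_pos h2]
  exact h2.choose_spec

end Complexification

end SkewFredholm

/-! ### The main theorem -/

theorem mainTheorem7 :
    -- complex Hilbert spaces
    (∀ (H : Type*) [NormedAddCommGroup H] [InnerProductSpace ℂ H] [CompleteSpace H]
      (D : H →ₗ.[ℂ] H) (Q : H →L[ℂ] H),
      IsSkewAdjointOp D → IsFredholmOp D →
      ContinuousLinearMap.adjoint Q = -Q → IsHilbertSchmidt Q →
      -- the operators `sign((1/i) D)` and `sign((1/i) (D + Q))` are well defined
      (∃! S, IsFunctionOf (overI D) Real.sign S) ∧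
      (∃! S, IsFunctionOf (overI (perturb D Q)) Real.sign S) ∧
      IsHilbertSchmidt (skewSign (perturb D Q) - skewSign D) ∧
      ∀ a : ℝ≥0∞, a = Metric.infEDist (0 : ℂ) (spectrumOp D ∪ spectrumOp (perturb D Q)) →
        (0 : ℂ) ∉ spectrumOp D → (0 : ℂ) ∉ spectrumOp (perturb D Q) →
        0 < a ∧ hsNorm (skewSign (perturb D Q) - skewSign D) ≤ hsNorm Q / a) ∧
    -- real Hilbert spaces; spectra and functional calculus are taken in the complexification
    (∀ (V : Type*) [NormedAddCommGroup V] [InnerProductSpace ℝ V] [CompleteSpace V]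
      (D : V →ₗ.[ℝ] V) (Q : V →L[ℝ] V),
      IsSkewAdjointOp D → IsFredholmOp D →
      ContinuousLinearMap.adjoint Q = -Q → IsHilbertSchmidt Q →
      (∃! S, IsFunctionOf (overI (Complexification.mapP D)) Real.sign S) ∧
      (∃! S, IsFunctionOf (overI (Complexification.mapP (perturb D Q))) Real.sign S) ∧
      -- `J_D` and `J_{D+Q}` are real operators
      Complexification.mapL (realSkewSign D) = skewSign (Complexification.mapP D) ∧
      Complexification.mapL (realSkewSign (perturb D Q)) =
        skewSign (Complexification.mapP (perturb D Q)) ∧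
      IsHilbertSchmidt (realSkewSign (perturb D Q) - realSkewSign D) ∧
      ∀ a : ℝ≥0∞,
        a = Metric.infEDist (0 : ℂ) (spectrumOp (Complexification.mapP D) ∪
          spectrumOp (Complexification.mapP (perturb D Q))) →
        (0 : ℂ) ∉ spectrumOp (Complexification.mapP D) →
        (0 : ℂ) ∉ spectrumOp (Complexification.mapP (perturb D Q)) →
        0 < a ∧ hsNorm (realSkewSign (perturb D Q) - realSkewSign D) ≤ hsNorm Q / a) := by
  refine ⟨?_, ?_⟩
  · intro H _ _ _ D Q hD hF hQ hQ2
    have hs := hD.isSkew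
    have he := hF.isEssBelow hs
    exact ⟨hs.existsUnique_sign, (hs.perturb hQ).existsUnique_sign,
      hs.isHilbertSchmidt_skewSign_sub he hQ hQ2,
      fun a ha h1 h2 => hs.hsNorm_skewSign_sub_le he hQ hQ2 ha h1 h2⟩
  · intro V _ _ _ D Q hD hF hQ hQ2
    have hs := hD.isSkew
    have hsc := Complexification.isSkew_mapP hs
    have hec := Complexification.isEssBelow_mapP (hF.isEssBelow hs)
    have hQc := Complexification.adjoint_mapL hQ
    have hQ2c : IsHilbertSchmidt (Complexification.mapL Q) := by
      rwa [IsHilbertSchmidt, Complexification.hsNorm_mapL]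
    have h1 := Complexification.mapL_realSkewSign hs
    have h2 := Complexification.mapL_realSkewSign (hs.perturb hQ)
    have h3 : hsNorm (realSkewSign (perturb D Q) - realSkewSign D) =
        hsNorm (skewSign (perturb (Complexification.mapP D) (Complexification.mapL Q)) -
          skewSign (Complexification.mapP D)) := by
      rw [← Complexification.hsNorm_mapL, Complexification.mapL_sub, h1, h2,
        Complexification.mapP_perturb]
    refine ⟨hsc.existsUnique_sign, (Complexification.isSkew_mapP (hs.perturb hQ)).existsUnique_sign,
      h1, h2, ?_, fun a ha h4 h5 => ?_⟩
    · rw [IsHilbertSchmidt, h3]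
      exact hsc.isHilbertSchmidt_skewSign_sub hec hQc hQ2c
    · rw [Complexification.mapP_perturb] at ha h5
      rw [h3, ← Complexification.hsNorm_mapL Q]
      exact hsc.hsNorm_skewSign_sub_le hec hQc hQ2c ha h4 h5
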